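/- **Setting.** A (finite-horizon) Dec-POMDP is a tuple $D=(\mathcal N,\mathcal S,\mathcal A=\prod_i\mathcal A_i,P,\mathcal R,\mathcal O=\prod_i\mathcal O_i,O,b_0,T)$ with agents $\mathcal N=\{1,\dots,N\}$, finite sets $\mathcal S,\mathcal A_i,\mathcal O_i$ of states, local actions and local observations, kernels $P:\mathcal S\times\mathcal A\to\Delta(\mathcal S)$ and $O:\mathcal S\times\mathcal A\to\Delta(\mathcal O)$, a reward $\mathcal R:\mathcal S\times\mathcal A\to\mathbb R$, an initial distribution $b_0\in\Delta(\mathcal S)$ and a horizon $T\in\mathbb N_0$. A local policy is a map $\pi_i:\bigcup_{0\le t\le T}(\mathcal A_i\times\mathcal O_i)^t\to\Delta(\mathcal A_i)$; $\Pi^D=\prod_i\Pi^D_i$ is the set of joint policies, with its Borel $\sigma$-algebra. Under $\mathbb P_\pi$, $S_0\sim b_0$, and for each $t$, $A_{i,t}\sim\pi_i(\cdot\mid \overline{AO}_{i,t})$ independently over $i$, where $\overline{AO}_{i,t}=(A_{i,0},O_{i,1},\dots,A_{i,t-1},O_{i,t})$, then $S_{t+1}\sim P(\cdot\mid S_t,A_t)$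 and $O_{t+1}\sim O(\cdot\mid S_{t+1},A_t)$. Put $J^D(\pi)=\mathbb E_\pi[\sum_{t=0}^T\mathcal R(S_t,A_t)]$. **Isomorphisms.** For Dec-POMDPs $D,E$ with the same horizon, $\mathrm{Iso}(D,E)$ is the set of tuples $f$ of bijections $f_N:\mathcal N^D\to\mathcal N^E$, $f_S:\mathcal S^D\to\mathcal S^E$, $f_{A_i}:\mathcal A^D_i\to\mathcal A^E_{f_N(i)}$, $f_{O_i}:\mathcal O^D_i\to\mathcal O^E_{f_N(i)}$ that preserve $P,O,\mathcal R,b_0$, where $f$ acts on joint actions by $(fa)_{f_N(i)}=f_{A_i}(a_i)$, and likewise on joint observations; $\mathrm{Aut}(D)=\mathrm{Iso}(D,D)$. The pushforward $f^*\pi\in\Pi^E$ is $(f^*\pi)_i(a_i\mid\tau)=\pi_{f^{-1}i}(f^{-1}a_i\mid f^{-1}\tau)$, and $f^*\nu$ is the image of a distribution $\nu$ on $\Pi^D$ under $f^*$. A labeling $f\in\mathrm{Sym}(D)$ is a tuple of bijections $\mathcal N\to\{1,\dots,N\}$, $\mathcal S\to\{1,\dots,|\mathcal S|\}$, $\mathcal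 A_i\to\{1,\dots,|\mathcal A_i|\}$, $\mathcal O_i\to\{1,\dots,|\mathcal O_i|\}$, and $f^*D$ is the Dec-POMDP obtained by transporting $D$ along $f$. Put $\mathcal D=\{f^*D\mid f\in\mathrm{Sym}(D)\}$, a finite set. **The LFC game.** A learning algorithm $\sigma\in\Sigma^{\mathcal D}$ assigns to each $E\in\mathcal D$ a probability measure $\sigma(E)$ on $\Pi^E$. In the label-free coordination (LFC) game for $D$ the players (principals) are $\mathcal N$, every strategy set is $\Sigma^{\mathcal D}$, and the common payoff is $$U^D(\sigma_1,\dots,\sigma_N)=\mathbb E_{D_i\sim\mathcal U(\mathcal D),\,i\in\mathcal N}\;\mathbb E_{f_j\sim\mathcal U(\mathrm{Iso}(D_j,D)),\,j\in\mathcal N}\;\mathbb E_{\pi^{(k)}\sim f_k^*\sigma_k(D_k),\,k\in\mathcal N}\big[J^D\big((\pi^{(l)}_l)_{l\in\mathcal N}\big)\big],$$ with all draws independent and $\mathcal U$ the uniform distribution. A profile $(\sigma_i)_i$ is a Nash equilibrium if $U^D(\sigma)\ge U^D(\sigma_i',\sigma_{-i})$ for all $i\in\mathcal N$ and $\sigma_i'\in\Sigma^{\mathcal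 D}$. **Other-play (OP).** For a Dec-POMDP $E$ and $\mathbf g\in\mathrm{Aut}(E)^{\mathcal N}$ let $\mathbf g^*\pi=((\mathbf g_i^*\pi)_i)_{i\in\mathcal N}$, $J^E_{\mathrm{OP}}(\pi)=\mathbb E_{\mathbf g\sim\mathcal U(\mathrm{Aut}(E)^{\mathcal N})}[J^E(\mathbf g^*\pi)]$ and $\Pi^E_{\mathrm{OP}}=\arg\max_{\pi\in\Pi^E} J^E_{\mathrm{OP}}(\pi)$. For a distribution $\mu_i$ on $\Pi^E_i$, the corresponding local policy $\pi_i^{\mu_i}$ is given by $\pi_i^{\mu_i}(a_i\mid\tau)=\mathbb P_{\mu_i\otimes\mu_{-i}}(A_{i,t}=a_i\mid\overline{AO}_{i,t}=\tau)$ for any product distribution $\mu_{-i}$ over the other agents' local policies such that $\mathbb P_{\mu_i\otimes\mu_{-i}}(\overline{AO}_{i,t}=\tau)>0$ (here a joint policy is first drawn from $\mu_i\otimes\mu_{-i}$ and then followed; the value does not depend on the choice of $\mu_{-i}$), and $\pi_i^{\mu_i}(a_i\mid\tau)=1/|\mathcal A_i|$ if there is no such $\mu_{-i}$. The symmetrizer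 is $\Psi^E(\pi)=(\pi_i^{\mu_i})_{i\in\mathcal N}$, where $\mu_i$ is the $i$-th marginal of the uniform mixture $\mu$ of the Dirac measures $\delta_{\mathbf g^*\pi}$, $\mathbf g\in\mathrm{Aut}(E)^{\mathcal N}$. Write $\pi\equiv_E\pi'$ if $\Psi^E(\pi)=\Psi^E(\pi')$, $[\pi]$ for the class of $\pi$, and $f^*[\pi]=[f^*\pi]$. **Tie-breaking.** A function $\chi$ assigning a value $\chi(E,\pi)\in[0,1]$ to each $E\in\mathcal D$ and $\pi\in\Pi^E$ is a tie-breaking function for $\mathcal D$ if for every $E\in\mathcal D$ (i) $\chi(E,\cdot)$ attains a maximum on $\Pi^E_{\mathrm{OP}}$, and (ii) $\chi(E,\pi)=\chi(E,\pi')$ implies $\pi\equiv_E\pi'$ for all $\pi,\pi'\in\Pi^E$. It is invariant to isomorphism if $f^*[\pi]=[\pi']$ implies $\chi(E,\pi)=\chi(F,\pi')$ for all $E,F\in\mathcal D$, $f\in\mathrm{Iso}(E,F)$, $\pi\in\Pi^E$, $\pi'\in\Pi^F$. For such a $\chi$, $\sigma^\chi\in\Sigma^{\mathcal D}$ is an OP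 with tie-breaking learning algorithm if for every $E\in\mathcal D$ there is a measurable set $\mathcal Z\subseteq\arg\max_{\pi\in\Pi^E_{\mathrm{OP}}}\chi(E,\pi)$ with $\sigma^\chi(E)(\mathcal Z)=1$. **Corollary.** Let $D$ be a Dec-POMDP, let $\chi$ be a tie-breaking function for $\mathcal D=\{f^*D\mid f\in\mathrm{Sym}(D)\}$ that is invariant to isomorphism, and let $\sigma^\chi$ be an OP with tie-breaking learning algorithm for $\mathcal D$. Then the profile $(\sigma^\chi,\dots,\sigma^\chi)$ in which every principal uses $\sigma^\chi$ is a Nash equilibrium of the LFC game for $D$. -/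

import Mathlib

open MeasureTheory ProbabilityTheory
open scoped BigOperators ENNReal

universe u v

/-- A finite-horizon Dec-POMDP with agents `Fin N` and horizon `T` (time steps `0, …, T`).
Probability mass functions on a finite set `X` are the elements of `stdSimplex ℝ X`. -/
structure DecPOMDP (N T : ℕ) where
  /-- states -/
  S : Type u
  /-- local actions of each agent -/
  A : Fin N → Type u
  /-- local observations of each agent -/
  O : Fin N → Type u
  [fintypeS : Fintype S]
  [fintypeA : ∀ i, Fintype (A i)]
  [fintypeO : ∀ i, Fintype (O i)]
  /-- transition kernel `P(· ∣ s, a)` -/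
  trans : S → (∀ i, A i) → stdSimplex ℝ S
  /-- joint reward function -/
  reward : S → (∀ i, A i) → ℝ
  /-- observation kernel `O(· ∣ s, a)` -/
  obs : S → (∀ i, A i) → stdSimplex ℝ (∀ i, O i)
  /-- initial state distribution `b₀` -/
  init : stdSimplex ℝ S

attribute [instance] DecPOMDP.fintypeS DecPOMDP.fintypeA DecPOMDP.fintypeO

noncomputable section

/-- Transport of a probability mass function along a bijection: `y ↦ p (e⁻¹ y)`. -/
def simplexCongr {X : Type u} {Y : Type v} [Fintype X] [Fintype Y] (e : X ≃ Y)
    (p : stdSimplex ℝ X) : stdSimplex ℝ Y :=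
  ⟨fun y => p (e.symm y), fun y => p.2.1 (e.symm y), by
    rw [← p.2.2]; exact Equiv.sum_comp e.symm (fun x => p x)⟩

namespace DecPOMDP

variable {N T : ℕ}

/-! ### Histories and policies -/

/-- Joint actions. -/
abbrev JointAction (D : DecPOMDP.{u} N T) : Type u := ∀ i, D.A i

/-- Joint observations. -/
abbrev JointObs (D : DecPOMDP.{u} N T) : Type u := ∀ i, D.O i

/-- Local action-observation histories of agent `i`: a length `t ∈ {0, …, T}` together with a
sequence `(a₀, o₁), …, (a_{t-1}, o_t)`. -/
abbrev AOHist (D : DecPOMDP.{u} N T) (i : Fin N) : Type u :=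
  Σ t : Fin (T + 1), Fin (t : ℕ) → D.A i × D.O i

/-- Local stochastic policies of agent `i`, with the Borel σ-algebra of
`[0,1] ^ (A_i × AOHist_i)` (the product of the subspace σ-algebras on the simplices). -/
abbrev LocalPolicy (D : DecPOMDP.{u} N T) (i : Fin N) : Type u :=
  D.AOHist i → stdSimplex ℝ (D.A i)

/-- Joint stochastic policies, with the product σ-algebra. -/
abbrev Policy (D : DecPOMDP.{u} N T) : Type u := ∀ i, D.LocalPolicy i

/-- Complete episodes: the states `s₀, …, s_T`, the joint actions `a₀, …, a_T` and the joint
observations `o₁, …, o_T`, where `obsSeq k` is `o_{k+1}`. -/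
@[ext]
structure Episode (D : DecPOMDP.{u} N T) where
  /-- `S_t` -/
  state : Fin (T + 1) → D.S
  /-- `A_t` -/
  action : Fin (T + 1) → D.JointAction
  /-- `O_{k+1}` -/
  obsSeq : Fin T → D.JointObs

instance (D : DecPOMDP.{u} N T) : Fintype D.Episode :=
  Fintype.ofEquiv
    ((Fin (T + 1) → D.S) × (Fin (T + 1) → D.JointAction) × (Fin T → D.JointObs))
    { toFun := fun x => ⟨x.1, x.2.1, x.2.2⟩
      invFun := fun ω => (ω.state, ω.action, ω.obsSeq)
      left_inv := fun _ => rfl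
      right_inv := fun _ => rfl }

instance (D : DecPOMDP.{u} N T) : MeasurableSpace D.Episode := ⊤

instance (D : DecPOMDP.{u} N T) : DiscreteMeasurableSpace D.Episode := ⟨fun _ => trivial⟩

namespace Episode

variable {D : DecPOMDP.{u} N T}

/-- The action-observation history `(A_{i,0}, O_{i,1}, …, A_{i,t-1}, O_{i,t})` of agent `i`. -/
def ao (ω : D.Episode) (i : Fin N) (t : Fin (T + 1)) : D.AOHist i :=
  ⟨t, fun k => (ω.action ⟨k, k.2.trans t.2⟩ i,
    ω.obsSeq ⟨k, lt_of_lt_of_le k.2 (Nat.lt_succ_iff.mp t.2)⟩ i)⟩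

/-- The return `∑_{t=0}^T R_t`. -/
def ret (ω : D.Episode) : ℝ := ∑ t, D.reward (ω.state t) (ω.action t)

end Episode

/-- The probability of an episode if the agents follow the joint policy `π`: the product of
`b₀(s₀)`, all `π_i(a_{i,t} ∣ τ_{i,t})`, and all
`P(s_{k+1} ∣ s_k, a_k) * O(o_{k+1} ∣ s_{k+1}, a_k)`. -/
def episodeProb (D : DecPOMDP.{u} N T) (π : D.Policy) (ω : D.Episode) : ℝ :=
  D.init (ω.state 0) *
    (∏ t : Fin (T + 1), ∏ i, π i (ω.ao i t) (ω.action t i)) *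
    ∏ k : Fin T,
      D.trans (ω.state k.castSucc) (ω.action k.castSucc) (ω.state k.succ) *
        D.obs (ω.state k.succ) (ω.action k.castSucc) (ω.obsSeq k)

/-- The measure `ℙ_π` on episodes. -/
def episodeMeasure (D : DecPOMDP.{u} N T) (π : D.Policy) : Measure D.Episode :=
  ∑ ω, ENNReal.ofReal (D.episodeProb π ω) • Measure.dirac ω

/-- The self-play objective `J^D(π) = 𝔼_π[∑_t R_t]`. -/
def J (D : DecPOMDP.{u} N T) (π : D.Policy) : ℝ :=
  ∫ ω, ω.ret ∂(D.episodeMeasure π)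

theorem measurable_episodeMeasure (D : DecPOMDP.{u} N T) : Measurable D.episodeMeasure := by
  refine Measure.measurable_of_measurable_coe _ fun s _ => ?_
  simp only [episodeMeasure, Measure.coe_finsetSum, Finset.sum_apply, Measure.smul_apply,
    smul_eq_mul]
  refine Finset.measurable_sum _ fun ω _ => Measurable.mul_const ?_ _
  refine ENNReal.measurable_ofReal.comp ?_
  unfold episodeProb
  refine Measurable.mul_const (Measurable.const_mul ?_ _) _
  refine Finset.measurable_prod _ fun t _ => Finset.measurable_prod _ fun i _ => ?_
  exact (measurable_pi_apply (ω.action t i)).comp (measurable_subtype_coe.comp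
    ((measurable_pi_apply (ω.ao i t)).comp (measurable_pi_apply i)))

/-- The kernel `π ↦ ℙ_π`. -/
def episodeKernel (D : DecPOMDP.{u} N T) : Kernel D.Policy D.Episode :=
  ⟨D.episodeMeasure, D.measurable_episodeMeasure⟩

theorem episodeProb_le_one (D : DecPOMDP.{u} N T) (π : D.Policy) (ω : D.Episode) :
    D.episodeProb π ω ≤ 1 := by
  have h0 : ∀ {X : Type u} [Fintype X] (p : stdSimplex ℝ X) (x : X), 0 ≤ p x :=
    fun p x => p.2.1 x
  have h1 : ∀ {X : Type u} [Fintype X] (p : stdSimplex ℝ X) (x : X), p x ≤ 1 := by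
    intro X _ p x
    rw [← p.2.2]
    exact Finset.single_le_sum (f := fun y => p y) (fun y _ => p.2.1 y) (Finset.mem_univ x)
  unfold episodeProb
  refine mul_le_one₀ (mul_le_one₀ (h1 _ _) ?_ ?_) ?_ ?_
  · exact Finset.prod_nonneg fun t _ => Finset.prod_nonneg fun i _ => h0 _ _
  · exact Finset.prod_le_one (fun t _ => Finset.prod_nonneg fun i _ => h0 _ _)
      fun t _ => Finset.prod_le_one (fun i _ => h0 _ _) fun i _ => h1 _ _
  · exact Finset.prod_nonneg fun k _ => mul_nonneg (h0 _ _) (h0 _ _)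
  · exact Finset.prod_le_one (fun k _ => mul_nonneg (h0 _ _) (h0 _ _))
      fun k _ => mul_le_one₀ (h1 _ _) (h0 _ _) (h1 _ _)

instance (D : DecPOMDP.{u} N T) : IsFiniteKernel D.episodeKernel := by
  refine ⟨⟨Fintype.card D.Episode, ENNReal.natCast_lt_top _, fun π => ?_⟩⟩
  change D.episodeMeasure π Set.univ ≤ _
  simp only [episodeMeasure, Measure.coe_finsetSum, Finset.sum_apply, Measure.smul_apply,
    smul_eq_mul, measure_univ, mul_one]
  calc ∑ ω, ENNReal.ofReal (D.episodeProb π ω) ≤ ∑ _ω : D.Episode, (1 : ℝ≥0∞) :=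
        Finset.sum_le_sum fun ω _ => ENNReal.ofReal_le_one.2 (D.episodeProb_le_one π ω)
    _ = Fintype.card D.Episode := by simp

/-! ### Isomorphisms and the pushforward of policies -/

/-- Isomorphisms from `D` to `E`. The joint maps `f_A`, `f_O` are given by `Equiv.piCongr`:
`(f_A a) (f_N i) = f_{A_i} (a i)`. -/
@[ext]
structure Iso (D : DecPOMDP.{u} N T) (E : DecPOMDP.{v} N T) where
  /-- `f_N` -/
  agent : Fin N ≃ Fin N
  /-- `f_S` -/
  state : D.S ≃ E.S
  /-- `f_{A_i}` -/
  action : ∀ i, D.A i ≃ E.A (agent i)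
  /-- `f_{O_i}` -/
  ob : ∀ i, D.O i ≃ E.O (agent i)
  trans_eq : ∀ s s' a,
    D.trans s a s' = E.trans (state s) (Equiv.piCongr agent action a) (state s')
  obs_eq : ∀ s a o,
    D.obs s a o = E.obs (state s) (Equiv.piCongr agent action a) (Equiv.piCongr agent ob o)
  reward_eq : ∀ s a, D.reward s a = E.reward (state s) (Equiv.piCongr agent action a)
  init_eq : ∀ s, D.init s = E.init (state s)

/-- Automorphisms. -/
abbrev Aut (D : DecPOMDP.{u} N T) : Type u := Iso D D

instance (D : DecPOMDP.{u} N T) (E : DecPOMDP.{v} N T) : Finite (Iso D E) := by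
  refine Finite.of_injective (β := Σ p : Fin N ≃ Fin N,
    (D.S ≃ E.S) × (∀ i, D.A i ≃ E.A (p i)) × (∀ i, D.O i ≃ E.O (p i)))
    (fun f => ⟨f.agent, f.state, f.action, f.ob⟩) ?_
  rintro ⟨p, s, a, o, _, _, _, _⟩ ⟨p', s', a', o', _, _, _, _⟩ h
  simp only [Sigma.mk.injEq] at h
  obtain ⟨rfl, h⟩ := h
  simp only [heq_eq_eq, Prod.mk.injEq] at h
  obtain ⟨rfl, rfl, rfl⟩ := h
  rfl

instance (D : DecPOMDP.{u} N T) (E : DecPOMDP.{v} N T) : Fintype (Iso D E) :=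
  Fintype.ofFinite _

namespace Iso

variable {D : DecPOMDP.{u} N T} {E : DecPOMDP.{v} N T}

/-- Element-wise action of an isomorphism on action-observation histories. -/
def aoMap (f : Iso D E) (i : Fin N) : D.AOHist i ≃ E.AOHist (f.agent i) :=
  Equiv.sigmaCongrRight fun _ =>
    Equiv.piCongrRight fun _ => Equiv.prodCongr (f.action i) (f.ob i)

/-- The local policy of agent `f i` that is obtained from a local policy of agent `i` by
precomposition with `f⁻¹`. -/
def localPush (f : Iso D E) (i : Fin N) : D.LocalPolicy i → E.LocalPolicy (f.agent i) :=
  fun πi τ => simplexCongr (f.action i) (πi ((f.aoMap i).symm τ))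

/-- The pushforward policy `f^*π`: agent `f i` gets the local policy of agent `i`, precomposed
with `f⁻¹`, that is `(f^*π)_{f i}(f a ∣ f τ) = π_i(a ∣ τ)`. -/
def push (f : Iso D E) (π : D.Policy) : E.Policy :=
  Equiv.piCongrLeft E.LocalPolicy f.agent fun i => f.localPush i (π i)

theorem push_apply (f : Iso D E) (π : D.Policy) (i : Fin N) :
    f.push π (f.agent i) = f.localPush i (π i) :=
  Equiv.piCongrLeft_apply_apply E.LocalPolicy f.agent (fun i => f.localPush i (π i)) i

theorem measurable_push (f : Iso D E) : Measurable f.push := by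
  refine measurable_pi_iff.2 fun j => ?_
  obtain ⟨i, rfl⟩ := f.agent.surjective j
  simp only [push_apply]
  refine measurable_pi_iff.2 fun τ => Measurable.subtype_mk (measurable_pi_iff.2 fun a => ?_)
  exact (measurable_pi_apply ((f.action i).symm a)).comp (measurable_subtype_coe.comp
    ((measurable_pi_apply ((f.aoMap i).symm τ)).comp (measurable_pi_apply i)))

/-- The pushforward `f^*ν` of a distribution over policies: the image measure under `f^*`. -/
def pushDist (f : Iso D E) (ν : ProbabilityMeasure D.Policy) : ProbabilityMeasure E.Policy :=
  ν.map f.measurable_push.aemeasurable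

end Iso

/-! ### Labelings and relabeled Dec-POMDPs -/

/-- Labelings `f ∈ Sym(D)`: bijections onto initial segments of the natural numbers. -/
@[ext]
structure Labeling (D : DecPOMDP.{u} N T) where
  /-- `f_N` -/
  agent : Fin N ≃ Fin N
  /-- `f_S` -/
  state : D.S ≃ Fin (Fintype.card D.S)
  /-- `f_{A_i}` -/
  action : ∀ i, D.A i ≃ Fin (Fintype.card (D.A i))
  /-- `f_{O_i}` -/
  ob : ∀ i, D.O i ≃ Fin (Fintype.card (D.O i))

instance (D : DecPOMDP.{u} N T) : Finite (Labeling D) :=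
  Finite.of_injective
    (fun f : Labeling D => (f.agent, f.state, f.action, f.ob)) fun f g h => by
      simp only [Prod.mk.injEq] at h
      exact Labeling.ext h.1 h.2.1 h.2.2.1 h.2.2.2

namespace Labeling

variable {D : DecPOMDP.{u} N T} (f : Labeling D)

/-- The induced bijection `f_A` from joint actions of `D` onto those of `f^*D`. -/
def jointAction :
    D.JointAction ≃ ∀ j, Fin (Fintype.card (D.A (f.agent.symm j))) :=
  Equiv.piCongr f.agent fun i => (f.action i).trans (finCongr (by rw [Equiv.symm_apply_apply]))

/-- The induced bijection `f_O` from joint observations of `D` onto those of `f^*D`. -/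
def jointObs :
    D.JointObs ≃ ∀ j, Fin (Fintype.card (D.O (f.agent.symm j))) :=
  Equiv.piCongr f.agent fun i => (f.ob i).trans (finCongr (by rw [Equiv.symm_apply_apply]))

/-- The relabeled Dec-POMDP `f^*D`. -/
def relabel : DecPOMDP.{0} N T where
  S := Fin (Fintype.card D.S)
  A j := Fin (Fintype.card (D.A (f.agent.symm j)))
  O j := Fin (Fintype.card (D.O (f.agent.symm j)))
  trans s a := simplexCongr f.state (D.trans (f.state.symm s) (f.jointAction.symm a))
  reward s a := D.reward (f.state.symm s) (f.jointAction.symm a)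
  obs s a := simplexCongr f.jointObs (D.obs (f.state.symm s) (f.jointAction.symm a))
  init := simplexCongr f.state D.init

end Labeling

/-- The set `{f^*D ∣ f ∈ Sym(D)}` of relabeled Dec-POMDPs. -/
def relabeled (D : DecPOMDP.{u} N T) : Set (DecPOMDP.{0} N T) :=
  Set.range (Labeling.relabel (D := D))

instance (D : DecPOMDP.{u} N T) : Fintype D.relabeled :=
  (Set.finite_range (Labeling.relabel (D := D))).fintype

/-! ### Learning algorithms and the label-free coordination game -/

/-- Learning algorithms for a set `C` of Dec-POMDPs. -/
abbrev LearningAlgorithm (C : Set (DecPOMDP.{u} N T)) : Type (u + 1) :=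
  ∀ E : C, ProbabilityMeasure E.1.Policy

/-- The common payoff `U^D(σ₁, …, σ_N)` of the label-free coordination game for `D`. The symbol
`𝔼 x, F x` is the uniform average over the finite type of `x`; the uniform distribution on a
product is the product of the uniform distributions. -/
def payoff (D : DecPOMDP.{u} N T) (σ : Fin N → LearningAlgorithm D.relabeled) : ℝ :=
  𝔼 Ds : Fin N → D.relabeled, 𝔼 f : (∀ j, Iso (Ds j).1 D),
    ∫ π : Fin N → D.Policy, D.J (fun l => π l l)
      ∂(Measure.pi fun k => ((f k).pushDist (σ k (Ds k)) : Measure D.Policy))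

/-- Nash equilibria of the label-free coordination game for `D`. -/
def IsNashEquilibrium (D : DecPOMDP.{u} N T) (σ : Fin N → LearningAlgorithm D.relabeled) :
    Prop :=
  ∀ (i : Fin N) (σ' : LearningAlgorithm D.relabeled),
    D.payoff (Function.update σ i σ') ≤ D.payoff σ

/-! ### Other-play -/

/-- For a profile `g` of automorphisms, the policy `g^*π` in which agent `i` follows its local
policy in `(g i)^*π`. -/
def profilePush (D : DecPOMDP.{u} N T) (g : Fin N → D.Aut) (π : D.Policy) : D.Policy :=
  fun i => (g i).push π i

/-- The other-play objective. -/
def JOP (D : DecPOMDP.{u} N T) (π : D.Policy) : ℝ :=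
  𝔼 g : Fin N → D.Aut, D.J (D.profilePush g π)

/-- The set `Π_OP` of OP-optimal policies. -/
def opOptimal (D : DecPOMDP.{u} N T) : Set D.Policy :=
  {π | ∀ π', D.JOP π' ≤ D.JOP π}

/-! ### Policies corresponding to distributions over policies, and the symmetrizer -/

/-- The law of the episode if first a joint policy is sampled, with independent local policies
`π_j ∼ μ_j`, and then the agents follow it (the marginal on episodes of `ℙ_μ`). -/
def mixMeasure (D : DecPOMDP.{u} N T) (μ : ∀ j, ProbabilityMeasure (D.LocalPolicy j)) :
    Measure D.Episode :=
  (Measure.pi fun j => (μ j : Measure (D.LocalPolicy j))).bind D.episodeKernel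

instance (D : DecPOMDP.{u} N T) (μ : ∀ j, ProbabilityMeasure (D.LocalPolicy j)) :
    IsFiniteMeasure (D.mixMeasure μ) := by
  unfold mixMeasure; infer_instance

/-- The event `{AO_{i,t} = τ}`, where `t` is the length of `τ`. -/
def aoEvent (D : DecPOMDP.{u} N T) (i : Fin N) (τ : D.AOHist i) : Set D.Episode :=
  {ω | ω.ao i τ.1 = τ}

/-- The conditional distribution of the action `A_{i,t}` given `AO_{i,t} = τ`. -/
def condAction (D : DecPOMDP.{u} N T) (i : Fin N) (τ : D.AOHist i) (ν : Measure D.Episode)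
    [IsFiniteMeasure ν] (h : ν (D.aoEvent i τ) ≠ 0) : stdSimplex ℝ (D.A i) :=
  ⟨fun a => (ProbabilityTheory.cond ν (D.aoEvent i τ)).real {ω | ω.action τ.1 i = a},
    fun _ => measureReal_nonneg, by
      have := cond_isProbabilityMeasure h
      have hs := sum_measureReal_preimage_singleton (μ := ProbabilityTheory.cond ν (D.aoEvent i τ))
        (f := fun ω : D.Episode => ω.action τ.1 i) Finset.univ
        (fun _ _ => MeasurableSet.of_discrete)
      simpa [Set.preimage, probReal_univ] using hs⟩

theorem nonempty_action (D : DecPOMDP.{u} N T) (i : Fin N)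
    (μ : ProbabilityMeasure (D.LocalPolicy i)) : Nonempty (D.A i) := by
  obtain ⟨π⟩ := μ.nonempty
  by_contra h
  rw [not_nonempty_iff] at h
  have := (π ⟨0, fun k => k.elim0⟩).2.2
  simp at this

open Classical in
/-- The local policy `π_i^{μ_i}` corresponding to a distribution `μ_i` over local policies of agent
`i`. Its value at `τ` is the conditional distribution of `A_{i,t}` given `AO_{i,t} = τ` under
`μ_i ⊗ μ_{-i}`, for any distribution `μ_{-i}` with independent local policies under which that
event has positive probability, and the uniform distribution if there is none. (The `i`-th
component of `μ` is overwritten by `μ_i`, so that `μ` only serves as `μ_{-i}`.) -/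
def correspondingLocal (D : DecPOMDP.{u} N T) (i : Fin N)
    (μi : ProbabilityMeasure (D.LocalPolicy i)) : D.LocalPolicy i := fun τ =>
  if h : ∃ μ : ∀ j, ProbabilityMeasure (D.LocalPolicy j),
      D.mixMeasure (Function.update μ i μi) (D.aoEvent i τ) ≠ 0 then
    D.condAction i τ (D.mixMeasure (Function.update h.choose i μi)) h.choose_spec
  else
    have := D.nonempty_action i μi
    stdSimplex.barycenter

instance (D : DecPOMDP.{u} N T) : Nonempty D.Aut :=
  ⟨{ agent := Equiv.refl _, state := Equiv.refl _, action := fun _ => Equiv.refl _,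
     ob := fun _ => Equiv.refl _, trans_eq := fun _ _ _ => rfl, obs_eq := fun _ _ _ => rfl,
     reward_eq := fun _ _ => rfl, init_eq := fun _ => rfl }⟩

/-- The other-play distribution of `π`: the uniform mixture of the Dirac measures at `g^*π`,
`g ∈ Aut(D)^N`. -/
def opDist (D : DecPOMDP.{u} N T) (π : D.Policy) : ProbabilityMeasure D.Policy :=
  ⟨(Fintype.card (Fin N → D.Aut) : ℝ≥0∞)⁻¹ •
      ∑ g : Fin N → D.Aut, Measure.dirac (D.profilePush g π), ⟨by
    simp only [Measure.smul_apply, Measure.coe_finsetSum, Finset.sum_apply, measure_univ,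
      Finset.sum_const, Finset.card_univ, nsmul_eq_mul, mul_one, smul_eq_mul]
    exact ENNReal.inv_mul_cancel (by simp [Fintype.card_ne_zero]) (ENNReal.natCast_ne_top _)⟩⟩

/-- The symmetrizer `Ψ^D(π) = π^μ`, where `μ` is the other-play distribution of `π`: the local
policy of agent `i` corresponds to the marginal `μ_i`. -/
def symmetrizer (D : DecPOMDP.{u} N T) (π : D.Policy) : D.Policy := fun i =>
  D.correspondingLocal i ((D.opDist π).map (measurable_pi_apply i).aemeasurable)

/-- Equivalence of policies, `π ≡_D π'`. -/
def Equivalent (D : DecPOMDP.{u} N T) (π π' : D.Policy) : Prop :=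
  D.symmetrizer π = D.symmetrizer π'

/-- The equivalence class `[π]`. -/
def eqClass (D : DecPOMDP.{u} N T) (π : D.Policy) : Set D.Policy :=
  {π' | D.Equivalent π' π}

/-! ### Other-play with tie-breaking -/

/-- `χ` is a tie-breaking function for the set `C`. -/
structure IsTieBreaking (C : Set (DecPOMDP.{u} N T))
    (χ : ∀ E : C, E.1.Policy → Set.Icc (0 : ℝ) 1) : Prop where
  attains_max : ∀ E : C, ∃ π ∈ E.1.opOptimal, ∀ π' ∈ E.1.opOptimal, χ E π' ≤ χ E π
  equivalent_of_eq : ∀ (E : C) (π π' : E.1.Policy), χ E π = χ E π' → E.1.Equivalent π π'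

/-- `χ` is invariant to isomorphism; here `f^*[π] = [f^*π]` by definition. -/
def InvariantToIso (C : Set (DecPOMDP.{u} N T))
    (χ : ∀ E : C, E.1.Policy → Set.Icc (0 : ℝ) 1) : Prop :=
  ∀ (E F : C) (f : Iso E.1 F.1) (π : E.1.Policy) (π' : F.1.Policy),
    F.1.eqClass (f.push π) = F.1.eqClass π' → χ E π = χ F π'

/-- `σ` is an OP with tie-breaking learning algorithm for `C` and the function `χ`. -/
def IsOPWithTieBreaking (C : Set (DecPOMDP.{u} N T))
    (χ : ∀ E : C, E.1.Policy → Set.Icc (0 : ℝ) 1) (σ : LearningAlgorithm C) : Prop :=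
  ∀ E : C, ∃ Z : Set E.1.Policy, MeasurableSet Z ∧ Z ⊆ E.1.opOptimal ∧
    (σ E : Measure E.1.Policy) Z = 1 ∧
    Z ⊆ {π | π ∈ E.1.opOptimal ∧ ∀ π' ∈ E.1.opOptimal, χ E π' ≤ χ E π}

end DecPOMDP

end

/-!
The probability of an episode is a product of a weight of the environment and one realization
weight per agent, so the expected return is multilinear in the realization weights. Other-play and
the label-free coordination game both evaluate it at independently averaged weights, for other-play
at averages over automorphisms. By Kuhn's theorem the realization weights of an agent form a convex
set. Along the segment from an optimum of other-play to another profile of averages, first-order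
optimality therefore says that the gains from the deviations of the single agents sum to at most
zero. Since automorphisms fix the optimal averages, the deviations need not be averaged, and letting
all agents but one keep their weights shows that no single agent gains.

Tie-breaking with an invariant `χ` makes the policies chosen on different relabelings equivalent
after transport. The symmetrizer of a policy determines its orbit averages on all episodes the
environment allows, so the profile in which everybody breaks ties by `χ` is evaluated at the
averages of one optimum of other-play, whereas a deviating learning algorithm contributes, again by
Kuhn's theorem, the realization weights of one local policy.
-/

universe w

noncomputable section

section Expectation

theorem multilinearMap_map_expect {ι : Type*} [Fintype ι] [DecidableEq ι] {κ : ι → Type*}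
    [∀ i, Fintype (κ i)] {M : ι → Type*} {M' : Type*} [∀ i, AddCommMonoid (M i)]
    [∀ i, Module ℚ≥0 (M i)] [AddCommMonoid M'] [Module ℚ≥0 M'] (f : MultilinearMap ℚ≥0 M M')
    (g : ∀ i, κ i → M i) :
    f (fun i => 𝔼 k, g i k) = 𝔼 p : ∀ i, κ i, f fun i => g i (p i) := by
  simp only [Finset.expect_univ, f.map_smul_univ, f.map_sum, Fintype.card_pi, Nat.cast_prod,
    Finset.prod_inv_distrib]

theorem expect_pi_eval {ι : Type*} [Fintype ι] [DecidableEq ι] {κ : ι → Type*}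
    [∀ i, Fintype (κ i)] [∀ i, Nonempty (κ i)] {M : Type*} [AddCommMonoid M] [Module ℚ≥0 M]
    (i : ι) (F : κ i → M) : 𝔼 p : ∀ i, κ i, F (p i) = 𝔼 k, F k := by
  rw [Fintype.expect_equiv (Equiv.piSplitAt i κ) (fun p => F (p i)) (fun q => F q.1)
      fun _ => rfl, ← Finset.univ_product_univ, Finset.expect_product' (f := fun k _ => F k)]
  simp only [Fintype.expect_const]

theorem expect_mem_of_convex {M : Type*} [AddCommGroup M] [Module ℝ M] [Module ℚ≥0 M]
    {s : Set M} (hs : Convex ℝ s) {κ : Type*} [Fintype κ] [Nonempty κ] {g : κ → M}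
    (hg : ∀ k, g k ∈ s) : 𝔼 k, g k ∈ s := by
  rw [Finset.expect_univ, ← NNRat.cast_smul_eq_nnqsmul ℝ, Finset.smul_sum]
  refine hs.sum_mem (fun _ _ => ?_) ?_ fun k _ => hg k
  · positivity
  · rw [Finset.sum_const, Finset.card_univ, nsmul_eq_mul, NNRat.cast_inv, NNRat.cast_natCast,
      mul_inv_cancel₀ (Nat.cast_ne_zero.2 Fintype.card_ne_zero)]

theorem integral_expect {X : Type*} [MeasurableSpace X] {μ : Measure X} {M : Type*}
    [NormedAddCommGroup M] [NormedSpace ℝ M] [Module ℚ≥0 M] {κ : Type*} [Fintype κ]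
    {g : κ → X → M} (hg : ∀ k, Integrable (g k) μ) :
    ∫ x, 𝔼 k, g k x ∂μ = 𝔼 k, ∫ x, g k x ∂μ := by
  simp only [Finset.expect_univ, ← NNRat.cast_smul_eq_nnqsmul ℝ]
  rw [integral_smul, integral_finsetSum _ fun k _ => hg k]

end Expectation

section Multilinear

variable {ι : Type*} [Fintype ι] [DecidableEq ι] {M : ι → Type*} [∀ i, NormedAddCommGroup (M i)]
  [∀ i, NormedSpace ℝ (M i)]

theorem sum_update_le_of_isMaxOn (f : ContinuousMultilinearMap ℝ M ℝ) {C : Set (∀ i, M i)}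
    (hC : Convex ℝ C) {r s : ∀ i, M i} (hr : r ∈ C) (hs : s ∈ C) (hmax : IsMaxOn f C r) :
    ∑ i, f (Function.update r i (s i)) ≤ Fintype.card ι * f r := by
  have hderiv := hmax.localize.hasFDerivWithinAt_nonpos (f.hasFDerivAt r).hasFDerivWithinAt
    (sub_mem_posTangentConeAt_of_segment_subset (hC.segment_subset hr hs))
  simpa only [ContinuousMultilinearMap.linearDeriv_apply, Pi.sub_apply, f.map_update_sub,
    Function.update_eq_self, Finset.sum_sub_distrib, Finset.sum_const, Finset.card_univ,
    nsmul_eq_mul, sub_nonpos] using hderiv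

end Multilinear

theorem exists_stdSimplex_integral_mul {X A : Type*} [MeasurableSpace X] [Nonempty X] [Fintype A]
    {μ : Measure X} {w : X → ℝ} (hw : Integrable w μ) (hw0 : ∀ x, 0 ≤ w x)
    {p : X → stdSimplex ℝ A} (hp : ∀ a, Measurable fun x => p x a) :
    ∃ q : stdSimplex ℝ A, ∀ a, (∫ x, w x ∂μ) * q a = ∫ x, w x * p x a ∂μ := by
  have hint (a : A) : Integrable (fun x => w x * p x a) μ :=
    hw.mul_bdd (hp a).aestronglyMeasurable (ae_of_all _ fun x => by
      rw [Real.norm_of_nonneg (stdSimplex.zero_le _ _)]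
      exact stdSimplex.le_one _ _)
  have hnonneg (a : A) : 0 ≤ ∫ x, w x * p x a ∂μ :=
    integral_nonneg fun x => mul_nonneg (hw0 x) (stdSimplex.zero_le _ _)
  have hsum : ∑ a, ∫ x, w x * p x a ∂μ = ∫ x, w x ∂μ := by
    rw [← integral_finsetSum _ fun a _ => hint a]
    simp only [← Finset.mul_sum, stdSimplex.sum_eq_one, mul_one]
  rcases eq_or_ne (∫ x, w x ∂μ) 0 with hzero | hne
  · refine ⟨p (Classical.arbitrary X), fun a => ?_⟩
    rw [hzero] at hsum ⊢
    rw [(Finset.sum_eq_zero_iff_of_nonneg fun a _ => hnonneg a).1 hsum a (Finset.mem_univ a),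
      zero_mul]
  · exact ⟨⟨fun a => (∫ x, w x * p x a ∂μ) / ∫ x, w x ∂μ,
      fun a => div_nonneg (hnonneg a) (integral_nonneg hw0),
      by rw [← Finset.sum_div, hsum, div_self hne]⟩, fun a => mul_div_cancel₀ _ hne⟩

section Trajectory

variable {S A O : Type*} {T : ℕ}

/-- The first `t` pairs `(a₀, o₁), …, (a_{t-1}, o_t)` of an action-observation sequence, where `o k`
is `o_{k+1}`. -/
def history (a : Fin (T + 1) → A) (o : Fin T → O) (t : Fin (T + 1)) : Fin (t : ℕ) → A × O :=
  fun k => (a ⟨k, k.2.trans t.2⟩, o ⟨k, lt_of_lt_of_le k.2 (Nat.lt_succ_iff.mp t.2)⟩)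

/-- The weight of a trajectory of a controlled hidden Markov chain with initial weights `b`,
transition kernel `p`, observation kernel `q` and history-dependent controller `c`. -/
def trajectoryWeight (b : S → ℝ) (p : S → A → S → ℝ) (q : S → A → O → ℝ)
    (c : ∀ t : Fin (T + 1), (Fin (t : ℕ) → A × O) → A → ℝ)
    (x : (Fin (T + 1) → S) × (Fin (T + 1) → A) × (Fin T → O)) : ℝ :=
  b (x.1 0) * (∏ t, c t (history x.2.1 x.2.2 t) (x.2.1 t)) *
    ∏ k : Fin T, p (x.1 k.castSucc) (x.2.1 k.castSucc) (x.1 k.succ) *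
      q (x.1 k.succ) (x.2.1 k.castSucc) (x.2.2 k)

/-- Splitting off the last state, action and observation of a trajectory. -/
def trajectorySnocEquiv (S A O : Type*) (T : ℕ) :
    ((Fin (T + 1) → S) × (Fin (T + 1) → A) × (Fin T → O)) × (S × O × A) ≃
      (Fin (T + 2) → S) × (Fin (T + 2) → A) × (Fin (T + 1) → O) where
  toFun z := (Fin.snoc z.1.1 z.2.1, Fin.snoc z.1.2.1 z.2.2.2, Fin.snoc z.1.2.2 z.2.2.1)
  invFun x := ((Fin.init x.1, Fin.init x.2.1, Fin.init x.2.2),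
    (x.1 (Fin.last _), x.2.2 (Fin.last _), x.2.1 (Fin.last _)))
  left_inv _ := by simp only [Fin.init_snoc, Fin.snoc_last]
  right_inv _ := by simp only [Fin.snoc_init_self]

theorem history_snoc_castSucc (a : Fin (T + 1) → A) (o : Fin T → O) (a' : A) (o' : O)
    (t : Fin (T + 1)) :
    history (Fin.snoc a a' : Fin (T + 2) → A) (Fin.snoc o o' : Fin (T + 1) → O) t.castSucc =
      history a o t := by
  funext k
  exact Prod.ext (Fin.snoc_castSucc (α := fun _ => A) a' a ⟨k, k.2.trans t.2⟩)
    (Fin.snoc_castSucc (α := fun _ => O) o' o ⟨k, lt_of_lt_of_le k.2 (Nat.lt_succ_iff.mp t.2)⟩)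

theorem history_snoc_last (a : Fin (T + 1) → A) (o : Fin (T + 1) → O) (a' : A) :
    history (Fin.snoc a a' : Fin (T + 2) → A) o (Fin.last (T + 1)) = fun k => (a k, o k) := by
  funext k
  exact Prod.ext (Fin.snoc_castSucc (α := fun _ => A) a' a k) rfl

theorem trajectoryWeight_snoc (b : S → ℝ) (p : S → A → S → ℝ) (q : S → A → O → ℝ)
    (c : ∀ t : Fin (T + 2), (Fin (t : ℕ) → A × O) → A → ℝ)
    (x : (Fin (T + 1) → S) × (Fin (T + 1) → A) × (Fin T → O)) (s : S) (o : O) (a : A) :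
    trajectoryWeight b p q c (trajectorySnocEquiv S A O T (x, (s, o, a))) =
      trajectoryWeight b p q (fun t => c t.castSucc) x *
        (p (x.1 (Fin.last T)) (x.2.1 (Fin.last T)) s * (q s (x.2.1 (Fin.last T)) o *
          c (Fin.last (T + 1))
            (fun k => (x.2.1 k, (Fin.snoc x.2.2 o : Fin (T + 1) → O) k)) a)) := by
  simp only [trajectoryWeight, trajectorySnocEquiv, Equiv.coe_fn_mk, Fin.prod_univ_castSucc,
    history_snoc_castSucc, history_snoc_last, Fin.snoc_castSucc, Fin.snoc_last,
    ← Fin.castSucc_succ, Fin.succ_last]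
  rw [← Fin.castSucc_zero, Fin.snoc_castSucc]
  ac_rfl

theorem sum_trajectoryWeight [Fintype S] [Fintype A] [Fintype O] (b : S → ℝ)
    {p : S → A → S → ℝ} (hp : ∀ s a, ∑ s', p s a s' = 1)
    {q : S → A → O → ℝ} (hq : ∀ s a, ∑ o, q s a o = 1)
    {c : ∀ t : Fin (T + 1), (Fin (t : ℕ) → A × O) → A → ℝ} (hc : ∀ t h, ∑ a, c t h a = 1) :
    ∑ x, trajectoryWeight b p q c x = ∑ s, b s := by
  induction T with
  | zero =>
    have hweight (s : S) (a : A) : trajectoryWeight b p q c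
        ((Equiv.funUnique (Fin 1) S).symm s, (Equiv.funUnique (Fin 1) A).symm a, default) =
          b s * c 0 Fin.elim0 a := by
      rw [trajectoryWeight, Fin.prod_univ_one, Finset.univ_eq_empty, Finset.prod_empty, mul_one]
      exact congrArg (fun h => b s * c 0 h a) (funext fun k => k.elim0)
    simp only [Fintype.sum_prod_type, ← Equiv.sum_comp (Equiv.funUnique (Fin 1) S).symm,
      ← Equiv.sum_comp (Equiv.funUnique (Fin 1) A).symm, Finset.univ_unique,
      Finset.sum_singleton]
    simp only [hweight, ← Finset.mul_sum, hc, mul_one]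
  | succ T ih =>
    rw [← Equiv.sum_comp (trajectorySnocEquiv S A O T), Fintype.sum_prod_type]
    simp only [Fintype.sum_prod_type (α₁ := S), Fintype.sum_prod_type (α₁ := O),
      trajectoryWeight_snoc, ← Finset.mul_sum, hc, hq, hp, mul_one]
    exact ih fun t => hc t.castSucc

end Trajectory

theorem simplexCongr_apply_apply {X : Type u} {Y : Type v} [Fintype X] [Fintype Y] (e : X ≃ Y)
    (p : stdSimplex ℝ X) (x : X) : simplexCongr e p (e x) = p x :=
  congrArg p (e.symm_apply_apply x)

section EquivFamily

variable {ι : Type*} {A : ι → Type u} {B : ι → Type v} {C : ι → Type w}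

theorem piCongr_trans_apply (e e' : ι ≃ ι) (p : ∀ i, A i ≃ B (e i)) (q : ∀ i, B i ≃ C (e' i))
    (a : ∀ i, A i) :
    Equiv.piCongr (W := A) (Z := C) (e.trans e') (fun i => (p i).trans (q (e i))) a =
      Equiv.piCongr e' q (Equiv.piCongr e p a) := by
  funext j
  obtain ⟨i, rfl⟩ := (e.trans e').surjective j
  rw [Equiv.piCongr_apply_apply]
  change _ = Equiv.piCongr e' q (Equiv.piCongr e p a) (e' (e i))
  rw [Equiv.piCongr_apply_apply, Equiv.piCongr_apply_apply]
  rfl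

/-- The inverse of a family of bijections over a permutation of the indices, as a family over the
inverse permutation. -/
def familySymm (e : ι ≃ ι) (p : ∀ i, A i ≃ B (e i)) (j : ι) : B j ≃ A (e.symm j) :=
  (Equiv.cast (congrArg B (e.apply_symm_apply j).symm)).trans (p (e.symm j)).symm

theorem familySymm_apply_apply_heq (e : ι ≃ ι) (p : ∀ i, A i ≃ B (e i)) (i : ι) (a : A i) :
    familySymm e p (e i) (p i a) ≍ a := by
  suffices h : ∀ j, j = i → ∀ hB : B (e i) = B (e j),
      (p j).symm (cast hB (p i a)) ≍ a from h _ (e.symm_apply_apply i) _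
  rintro _ rfl _
  rw [cast_eq, Equiv.symm_apply_apply]

theorem apply_familySymm_apply_heq (e : ι ≃ ι) (p : ∀ i, A i ≃ B (e i)) (j : ι) (b : B j) :
    p (e.symm j) (familySymm e p j b) ≍ b := by
  suffices h : ∀ (i : ι) (hB : B j = B (e i)), p i ((p i).symm (cast hB b)) ≍ b from h _ _
  intro i hB
  rw [Equiv.apply_symm_apply]
  exact cast_heq hB b

theorem piCongr_familySymm_apply (e : ι ≃ ι) (p : ∀ i, A i ≃ B (e i)) (b : ∀ i, B i) :
    Equiv.piCongr (W := B) (Z := A) e.symm (familySymm e p) b = (Equiv.piCongr e p).symm b := by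
  obtain ⟨a, rfl⟩ := (Equiv.piCongr e p).surjective b
  rw [Equiv.symm_apply_apply]
  funext i
  obtain ⟨i, rfl⟩ := (e.trans e.symm).surjective i
  refine (Equiv.piCongr_apply_apply e.symm (familySymm e p) _ (e i)).trans (eq_of_heq ?_)
  rw [Equiv.piCongr_apply_apply]
  exact (familySymm_apply_apply_heq e p i (a i)).trans
    (congr_arg_heq a (e.symm_apply_apply i).symm)

end EquivFamily

namespace DecPOMDP

variable {N T : ℕ}

section Realization

variable (D : DecPOMDP.{u} N T) (i : Fin N)

/-- The contribution of the initial state, the transitions and the observations to the probability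
of an episode. -/
def envWeight (ω : D.Episode) : ℝ :=
  D.init (ω.state 0) * ∏ k : Fin T,
      D.trans (ω.state k.castSucc) (ω.action k.castSucc) (ω.state k.succ) *
        D.obs (ω.state k.succ) (ω.action k.castSucc) (ω.obsSeq k)

/-- The realization weights of a local policy: its contribution to the probability of each
episode. -/
def realizationWeight (x : D.LocalPolicy i) : D.Episode → ℝ :=
  fun ω => ∏ t : Fin (T + 1), x (ω.ao i t) (ω.action t i)

/-- The contribution of a local policy to the probability of a local history. -/
def histWeight (x : D.LocalPolicy i) (τ : D.AOHist i) : ℝ :=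
  ∏ k : Fin (τ.1 : ℕ), x ⟨⟨k, k.2.trans τ.1.2⟩, fun j => τ.2 ⟨j, j.2.trans k.2⟩⟩ (τ.2 k).1

theorem envWeight_nonneg (ω : D.Episode) : 0 ≤ D.envWeight ω :=
  mul_nonneg (stdSimplex.zero_le _ _) (Finset.prod_nonneg fun _ _ =>
    mul_nonneg (stdSimplex.zero_le _ _) (stdSimplex.zero_le _ _))

theorem realizationWeight_mem_Icc (x : D.LocalPolicy i) (ω : D.Episode) :
    D.realizationWeight i x ω ∈ Set.Icc 0 1 :=
  ⟨Finset.prod_nonneg fun _ _ => stdSimplex.zero_le _ _,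
    Finset.prod_le_one (fun _ _ => stdSimplex.zero_le _ _) fun _ _ => stdSimplex.le_one _ _⟩

theorem histWeight_mem_Icc (x : D.LocalPolicy i) (τ : D.AOHist i) :
    D.histWeight i x τ ∈ Set.Icc 0 1 :=
  ⟨Finset.prod_nonneg fun _ _ => stdSimplex.zero_le _ _,
    Finset.prod_le_one (fun _ _ => stdSimplex.zero_le _ _) fun _ _ => stdSimplex.le_one _ _⟩

theorem measurable_localPolicy_apply (τ : D.AOHist i) (a : D.A i) :
    Measurable fun x : D.LocalPolicy i => x τ a :=
  (measurable_pi_apply a).comp (measurable_subtype_coe.comp (measurable_pi_apply τ))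

theorem measurable_realizationWeight : Measurable (D.realizationWeight i) :=
  measurable_pi_iff.2 fun _ =>
    Finset.measurable_prod _ fun _ _ => D.measurable_localPolicy_apply i _ _

theorem measurable_histWeight (τ : D.AOHist i) :
    Measurable fun x : D.LocalPolicy i => D.histWeight i x τ :=
  Finset.measurable_prod _ fun _ _ => D.measurable_localPolicy_apply i _ _

theorem integrable_realizationWeight (μ : Measure (D.LocalPolicy i)) [IsFiniteMeasure μ] :
    Integrable (D.realizationWeight i) μ :=
  Integrable.of_eval fun ω => Integrable.of_mem_Icc 0 1
    (measurable_pi_iff.1 (D.measurable_realizationWeight i) ω).aemeasurable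
    (ae_of_all _ fun x => D.realizationWeight_mem_Icc i x ω)

theorem measurable_realizationWeight_apply :
    Measurable fun π : D.Policy => D.realizationWeight i (π i) :=
  (D.measurable_realizationWeight i).comp (measurable_pi_apply i)

theorem integrable_realizationWeight_apply (μ : Measure D.Policy) [IsFiniteMeasure μ] :
    Integrable (fun π => D.realizationWeight i (π i)) μ :=
  (D.integrable_realizationWeight i _).comp_measurable (measurable_pi_apply i)

theorem integrable_histWeight (τ : D.AOHist i) (μ : Measure (D.LocalPolicy i))
    [IsFiniteMeasure μ] : Integrable (fun x => D.histWeight i x τ) μ :=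
  Integrable.of_mem_Icc 0 1 (D.measurable_histWeight i τ).aemeasurable
    (ae_of_all _ fun x => D.histWeight_mem_Icc i x τ)

theorem histWeight_ao_zero (x : D.LocalPolicy i) (ω : D.Episode) :
    D.histWeight i x (ω.ao i 0) = 1 :=
  Finset.prod_of_isEmpty (ι := Fin 0) _

theorem histWeight_ao_succ (x : D.LocalPolicy i) (ω : D.Episode) (t : Fin T) :
    D.histWeight i x (ω.ao i t.succ) =
      D.histWeight i x (ω.ao i t.castSucc) *
        x (ω.ao i t.castSucc) (ω.action t.castSucc i) :=
  Fin.prod_univ_castSucc (n := t) _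

theorem realizationWeight_eq_histWeight_mul (x : D.LocalPolicy i) (ω : D.Episode) :
    D.realizationWeight i x ω =
      D.histWeight i x (ω.ao i (Fin.last T)) *
        x (ω.ao i (Fin.last T)) (ω.action (Fin.last T) i) :=
  Fin.prod_univ_castSucc _

/-- Kuhn's theorem. -/
theorem exists_realizationWeight_eq_integral (μ : Measure (D.LocalPolicy i))
    [IsProbabilityMeasure μ] :
    ∃ y, D.realizationWeight i y = ∫ x, D.realizationWeight i x ∂μ := by
  have : Nonempty (D.LocalPolicy i) := nonempty_of_isProbabilityMeasure μ
  choose y hy using fun τ => exists_stdSimplex_integral_mul (D.integrable_histWeight i τ μ)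
    (fun x => (D.histWeight_mem_Icc i x τ).1) (D.measurable_localPolicy_apply i τ)
  have hhist (ω : D.Episode) (t : Fin (T + 1)) :
      D.histWeight i y (ω.ao i t) = ∫ x, D.histWeight i x (ω.ao i t) ∂μ := by
    induction t using Fin.induction with
    | zero => simp only [histWeight_ao_zero, integral_const, probReal_univ, one_smul]
    | succ t ih => simp only [histWeight_ao_succ, ih, hy]
  refine ⟨y, funext fun ω => ?_⟩
  rw [eval_integral fun ω => (D.integrable_realizationWeight i μ).eval ω]
  simp only [realizationWeight_eq_histWeight_mul, hhist, hy]

theorem convex_range_realizationWeight : Convex ℝ (Set.range (D.realizationWeight i)) := by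
  rintro _ ⟨x, rfl⟩ _ ⟨y, rfl⟩ a b ha hb hab
  have : IsProbabilityMeasure
      (ENNReal.ofReal a • Measure.dirac x + ENNReal.ofReal b • Measure.dirac y) :=
    ⟨by simp only [Measure.add_apply, Measure.smul_apply, measure_univ, smul_eq_mul, mul_one,
      ← ENNReal.ofReal_add ha hb, hab, ENNReal.ofReal_one]⟩
  obtain ⟨z, hz⟩ := D.exists_realizationWeight_eq_integral i
    (ENNReal.ofReal a • Measure.dirac x + ENNReal.ofReal b • Measure.dirac y)
  have hint (x : D.LocalPolicy i) {c : ℝ} :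
      Integrable (D.realizationWeight i) (ENNReal.ofReal c • Measure.dirac x) :=
    (D.integrable_realizationWeight i _).smul_measure ENNReal.ofReal_ne_top
  have hmeas := (D.measurable_realizationWeight i).stronglyMeasurable
  refine ⟨z, ?_⟩
  rw [hz, integral_add_measure (hint x) (hint y), integral_smul_measure, integral_smul_measure,
    integral_dirac' _ _ hmeas, integral_dirac' _ _ hmeas, ENNReal.toReal_ofReal ha,
    ENNReal.toReal_ofReal hb]

end Realization

section EpisodeMeasure

variable (D : DecPOMDP.{u} N T) (π : D.Policy)

theorem episodeProb_eq (ω : D.Episode) :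
    D.episodeProb π ω = D.envWeight ω * ∏ i, D.realizationWeight i (π i) ω := by
  simp only [episodeProb, envWeight, realizationWeight]
  rw [Finset.prod_comm, mul_right_comm]

theorem episodeProb_nonneg (ω : D.Episode) : 0 ≤ D.episodeProb π ω := by
  rw [episodeProb_eq]
  exact mul_nonneg (D.envWeight_nonneg ω)
    (Finset.prod_nonneg fun i _ => (D.realizationWeight_mem_Icc i _ ω).1)

/-- Episodes as triples of sequences. -/
def episodeEquiv :
    ((Fin (T + 1) → D.S) × (Fin (T + 1) → D.JointAction) × (Fin T → D.JointObs)) ≃ D.Episode where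
  toFun x := ⟨x.1, x.2.1, x.2.2⟩
  invFun ω := (ω.state, ω.action, ω.obsSeq)
  left_inv _ := rfl
  right_inv _ := rfl

theorem sum_episodeProb : ∑ ω, D.episodeProb π ω = 1 := by
  classical
  rw [← Equiv.sum_comp D.episodeEquiv, ← stdSimplex.sum_eq_one D.init]
  refine sum_trajectoryWeight (p := fun s a s' => D.trans s a s') (q := fun s a o => D.obs s a o)
    (c := fun t h a => ∏ i, π i ⟨t, fun k => ((h k).1 i, (h k).2 i)⟩ (a i)) (fun s => D.init s)
    (fun _ _ => stdSimplex.sum_eq_one _) (fun _ _ => stdSimplex.sum_eq_one _) fun t h => ?_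
  rw [← Fintype.prod_sum fun i b => π i ⟨t, fun k => ((h k).1 i, (h k).2 i)⟩ b]
  simp only [stdSimplex.sum_eq_one, Finset.prod_const_one]

theorem episodeMeasure_real (s : Set D.Episode) :
    (D.episodeMeasure π).real s = ∑ ω, s.indicator (D.episodeProb π) ω := by
  classical
  simp only [episodeMeasure, Measure.real, Measure.coe_finsetSum, Finset.sum_apply,
    Measure.smul_apply, smul_eq_mul, Measure.dirac_apply' _ (MeasurableSet.of_discrete (s := s))]
  rw [ENNReal.toReal_sum fun ω _ => ENNReal.mul_ne_top ENNReal.ofReal_ne_top (by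
    by_cases h : ω ∈ s <;> simp [h])]
  refine Finset.sum_congr rfl fun ω _ => ?_
  by_cases h : ω ∈ s <;> simp [h, D.episodeProb_nonneg]

instance : IsProbabilityMeasure (D.episodeMeasure π) :=
  isProbabilityMeasure_iff_real.2 <| by
    rw [episodeMeasure_real, Set.indicator_univ, sum_episodeProb]

theorem episodeMeasure_real_singleton (ω : D.Episode) :
    (D.episodeMeasure π).real {ω} = D.episodeProb π ω := by
  rw [episodeMeasure_real, Finset.sum_eq_single ω, Set.indicator_of_mem (Set.mem_singleton ω)]
  · exact fun ω' _ h => Set.indicator_of_notMem (Set.notMem_singleton_iff.2 h) _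
  · exact fun h => (h (Finset.mem_univ ω)).elim

theorem integral_episodeMeasure (F : D.Episode → ℝ) :
    ∫ ω, F ω ∂(D.episodeMeasure π) = ∑ ω, D.episodeProb π ω * F ω := by
  simp only [integral_fintype Integrable.of_finite, episodeMeasure_real_singleton, smul_eq_mul]

end EpisodeMeasure

section Conditional

variable (D : DecPOMDP.{u} N T)

theorem mixMeasure_eq_episodeMeasure (μ : ∀ j, ProbabilityMeasure (D.LocalPolicy j))
    (π : D.Policy)
    (h : ∀ j, D.realizationWeight j (π j) = ∫ x, D.realizationWeight j x ∂(μ j).toMeasure) :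
    D.mixMeasure μ = D.episodeMeasure π := by
  refine Measure.ext_of_singleton fun ω => (measureReal_eq_measureReal_iff).1 ?_
  have hint (j : Fin N) := (D.integrable_realizationWeight j (μ j).toMeasure).eval
  have hprob : (D.mixMeasure μ).real {ω} =
      ∫ π', D.episodeProb π' ω ∂(Measure.pi fun j => (μ j).toMeasure) := by
    rw [Measure.real, mixMeasure, Measure.bind_apply .of_discrete D.episodeKernel.aemeasurable,
      ← integral_toReal (D.episodeKernel.measurable_coe .of_discrete).aemeasurable
        (ae_of_all _ fun π' => measure_lt_top (D.episodeMeasure π') _)]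
    exact integral_congr_ae (ae_of_all _ fun π' => D.episodeMeasure_real_singleton π' ω)
  simp only [hprob, episodeMeasure_real_singleton, episodeProb_eq, h, integral_const_mul,
    integral_fintype_prod_eq_prod fun j x => D.realizationWeight j x ω,
    eval_integral (hint _)]

/-- The counterfactual reach of agent `i`: the contribution of the environment and the other agents
to the probability of each episode. -/
def counterfactualWeight (π : D.Policy) (i : Fin N) (ω : D.Episode) : ℝ :=
  D.envWeight ω * ∏ j ∈ Finset.univ.erase i, D.realizationWeight j (π j) ω

variable (π : D.Policy) (i : Fin N)

theorem counterfactualWeight_nonneg (ω : D.Episode) : 0 ≤ D.counterfactualWeight π i ω :=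
  mul_nonneg (D.envWeight_nonneg ω)
    (Finset.prod_nonneg fun j _ => (D.realizationWeight_mem_Icc j _ ω).1)

theorem episodeProb_update (x : D.LocalPolicy i) (ω : D.Episode) :
    D.episodeProb (Function.update π i x) ω =
      D.counterfactualWeight π i ω * D.realizationWeight i x ω := by
  rw [episodeProb_eq, counterfactualWeight, ← Finset.prod_erase_mul _ _ (Finset.mem_univ i),
    Function.update_self, ← mul_assoc,
    Finset.prod_congr rfl fun j hj => by rw [Function.update_of_ne (Finset.ne_of_mem_erase hj)]]

theorem episodeProb_eq_counterfactualWeight_mul (ω : D.Episode) :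
    D.episodeProb π ω = D.counterfactualWeight π i ω * D.realizationWeight i (π i) ω := by
  rw [← episodeProb_update, Function.update_eq_self]

section Deviation

variable [DecidableEq (D.AOHist i)]

theorem realizationWeight_update_of_notMem_aoEvent (x : D.LocalPolicy i) {τ : D.AOHist i}
    (p : stdSimplex ℝ (D.A i)) {ω : D.Episode} (h : ω ∉ D.aoEvent i τ) :
    D.realizationWeight i (Function.update x τ p) ω = D.realizationWeight i x ω :=
  Finset.prod_congr rfl fun t _ => by
    rw [Function.update_of_ne]
    rintro rfl
    exact h rfl

theorem mul_realizationWeight_update_of_mem_aoEvent (x : D.LocalPolicy i) {τ : D.AOHist i}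
    (p : stdSimplex ℝ (D.A i)) {ω : D.Episode} (h : ω ∈ D.aoEvent i τ) :
    x τ (ω.action τ.1 i) * D.realizationWeight i (Function.update x τ p) ω =
      p (ω.action τ.1 i) * D.realizationWeight i x ω := by
  have hτ : ω.ao i τ.1 = τ := h
  have hne (t : Fin (T + 1)) (ht : t ∈ Finset.univ.erase τ.1) : ω.ao i t ≠ τ := fun hc =>
    Finset.ne_of_mem_erase ht (congrArg Sigma.fst hc)
  simp only [realizationWeight, ← Finset.mul_prod_erase _ _ (Finset.mem_univ τ.1), hτ,
    Function.update_self]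
  rw [Finset.prod_congr rfl fun t ht => by rw [Function.update_of_ne (hne t ht)]]
  exact mul_left_comm _ _ _

theorem indicator_episodeProb_eq_mul_update [DecidableEq (D.A i)] (τ : D.AOHist i)
    (a : D.A i) (ω : D.Episode) :
    (D.aoEvent i τ ∩ {ω | ω.action τ.1 i = a}).indicator (D.episodeProb π) ω =
      π i τ a * (D.aoEvent i τ).indicator (D.episodeProb
        (Function.update π i (Function.update (π i) τ (stdSimplex.vertex a)))) ω := by
  by_cases hτ : ω ∈ D.aoEvent i τ
  swap
  · rw [Set.indicator_of_notMem (fun h => hτ h.1), Set.indicator_of_notMem hτ, mul_zero]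
  have hvertex := D.mul_realizationWeight_update_of_mem_aoEvent i (π i) (stdSimplex.vertex a) hτ
  rw [Set.indicator_of_mem hτ, episodeProb_update, mul_left_comm]
  by_cases ha : ω.action τ.1 i = a
  · rw [ha, stdSimplex.vertex_coe, Pi.single_eq_same, one_mul] at hvertex
    rw [Set.indicator_of_mem (Set.mem_inter hτ ha), hvertex,
      episodeProb_eq_counterfactualWeight_mul]
  · have hzero : D.realizationWeight i (Function.update (π i) τ (stdSimplex.vertex a)) ω = 0 :=
      Finset.prod_eq_zero (Finset.mem_univ τ.1) (by
        rw [show ω.ao i τ.1 = τ from hτ, Function.update_self, stdSimplex.vertex_coe,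
          Pi.single_eq_of_ne ha])
    rw [Set.indicator_of_notMem (fun h => ha h.2), hzero, mul_zero, mul_zero]

theorem episodeMeasure_real_aoEvent_update (τ : D.AOHist i) (p : stdSimplex ℝ (D.A i)) :
    (D.episodeMeasure (Function.update π i (Function.update (π i) τ p))).real (D.aoEvent i τ) =
      (D.episodeMeasure π).real (D.aoEvent i τ) := by
  have hout : Set.EqOn (D.episodeProb (Function.update π i (Function.update (π i) τ p)))
      (D.episodeProb π) (D.aoEvent i τ)ᶜ := fun ω hω => by
    rw [episodeProb_update, D.realizationWeight_update_of_notMem_aoEvent i _ _ hω,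
      ← episodeProb_eq_counterfactualWeight_mul]
  have hcompl : (D.episodeMeasure (Function.update π i (Function.update (π i) τ p))).real
      (D.aoEvent i τ)ᶜ = (D.episodeMeasure π).real (D.aoEvent i τ)ᶜ := by
    simp only [episodeMeasure_real, Set.indicator_congr hout]
  simpa only [probReal_compl_eq_one_sub .of_discrete, sub_right_inj] using hcompl

end Deviation

theorem episodeMeasure_real_aoEvent_inter_action (τ : D.AOHist i) (a : D.A i) :
    (D.episodeMeasure π).real (D.aoEvent i τ ∩ {ω | ω.action τ.1 i = a}) =
      π i τ a * (D.episodeMeasure π).real (D.aoEvent i τ) := by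
  classical
  rw [← D.episodeMeasure_real_aoEvent_update π i τ (stdSimplex.vertex a), episodeMeasure_real,
    episodeMeasure_real, Finset.mul_sum]
  exact Finset.sum_congr rfl fun ω _ => D.indicator_episodeProb_eq_mul_update π i τ a ω

theorem condAction_episodeMeasure (τ : D.AOHist i) (h : D.episodeMeasure π (D.aoEvent i τ) ≠ 0) :
    D.condAction i τ (D.episodeMeasure π) h = π i τ :=
  Subtype.ext <| funext fun a => by
    change (cond (D.episodeMeasure π) (D.aoEvent i τ)).real {ω | ω.action τ.1 i = a} = π i τ a
    rw [Measure.real, cond_apply .of_discrete, ENNReal.toReal_mul, ENNReal.toReal_inv,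
      ← measureReal_def, ← measureReal_def, episodeMeasure_real_aoEvent_inter_action, mul_comm,
      mul_inv_cancel_right₀ ((measureReal_ne_zero_iff).2 h)]

end Conditional

section CorrespondingLocal

variable (D : DecPOMDP.{u} N T) (i : Fin N)

/-- The joint policy that always plays uniformly at random. -/
def uniformPolicy [∀ j, Nonempty (D.A j)] : D.Policy :=
  fun _ _ => stdSimplex.barycenter

theorem counterfactualWeight_uniformPolicy_pos [∀ j, Nonempty (D.A j)] {ω : D.Episode}
    (hω : D.envWeight ω ≠ 0) : 0 < D.counterfactualWeight D.uniformPolicy i ω :=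
  mul_pos ((D.envWeight_nonneg ω).lt_of_ne' hω) <| Finset.prod_pos fun j _ =>
    Finset.prod_pos fun t _ => by
      change 0 < ((Fintype.card (D.A j) : ℝ)⁻¹)
      exact inv_pos.2 (Nat.cast_pos.2 Fintype.card_pos)

theorem eqOn_realizationWeight_of_le {x y : D.LocalPolicy i}
    (h : ∀ ω, D.envWeight ω ≠ 0 → D.realizationWeight i y ω ≤ D.realizationWeight i x ω) :
    Set.EqOn (D.realizationWeight i x) (D.realizationWeight i y)
      (Function.support D.envWeight) := by
  intro ω hω
  have (j : Fin N) : Nonempty (D.A j) := ⟨ω.action 0 j⟩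
  have hle (ω : D.Episode) : D.episodeProb (Function.update D.uniformPolicy i y) ω ≤
      D.episodeProb (Function.update D.uniformPolicy i x) ω := by
    rw [episodeProb_update, episodeProb_update]
    rcases eq_or_ne (D.envWeight ω) 0 with hzero | hne
    · simp only [counterfactualWeight, hzero, zero_mul, le_refl]
    · exact mul_le_mul_of_nonneg_left (h ω hne) (D.counterfactualWeight_nonneg _ i ω)
  have heq := (Finset.sum_eq_sum_iff_of_le fun ω _ => hle ω).1
    ((D.sum_episodeProb _).trans (D.sum_episodeProb _).symm) ω (Finset.mem_univ ω)
  rw [episodeProb_update, episodeProb_update] at heq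
  exact (mul_left_cancel₀ (D.counterfactualWeight_uniformPolicy_pos i hω).ne' heq).symm

variable {i} {y : D.LocalPolicy i} {μi : ProbabilityMeasure (D.LocalPolicy i)}

theorem mixMeasure_update_eq_episodeMeasure
    (hy : D.realizationWeight i y = ∫ x, D.realizationWeight i x ∂μi.toMeasure)
    {μ : ∀ j, ProbabilityMeasure (D.LocalPolicy j)} {π : D.Policy}
    (h : ∀ j, D.realizationWeight j (π j) = ∫ x, D.realizationWeight j x ∂(μ j).toMeasure) :
    D.mixMeasure (Function.update μ i μi) = D.episodeMeasure (Function.update π i y) := by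
  refine D.mixMeasure_eq_episodeMeasure _ _ fun j => ?_
  rcases eq_or_ne j i with rfl | hj
  · simpa only [Function.update_self] using hy
  · simpa only [Function.update_of_ne hj] using h j

theorem correspondingLocal_apply_of_reachable
    (hy : D.realizationWeight i y = ∫ x, D.realizationWeight i x ∂μi.toMeasure)
    {τ : D.AOHist i} (h : ∃ μ : ∀ j, ProbabilityMeasure (D.LocalPolicy j),
      D.mixMeasure (Function.update μ i μi) (D.aoEvent i τ) ≠ 0) :
    D.correspondingLocal i μi τ = y τ := by
  choose π hπ using fun j => D.exists_realizationWeight_eq_integral j (h.choose j).toMeasure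
  have hmix := D.mixMeasure_update_eq_episodeMeasure hy hπ
  have hpos := h.choose_spec
  rw [correspondingLocal, dif_pos h]
  simp only [hmix] at hpos ⊢
  rw [condAction_episodeMeasure, Function.update_self]

theorem exists_mixMeasure_update_aoEvent_ne_zero
    (hy : D.realizationWeight i y = ∫ x, D.realizationWeight i x ∂μi.toMeasure)
    {ω : D.Episode} (hω : D.envWeight ω ≠ 0) (hyω : D.realizationWeight i y ω ≠ 0)
    (t : Fin (T + 1)) : ∃ μ : ∀ j, ProbabilityMeasure (D.LocalPolicy j),
      D.mixMeasure (Function.update μ i μi) (D.aoEvent i (ω.ao i t)) ≠ 0 := by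
  have (j : Fin N) : Nonempty (D.A j) := ⟨ω.action 0 j⟩
  refine ⟨fun j => diracProba (D.uniformPolicy j), ?_⟩
  rw [D.mixMeasure_update_eq_episodeMeasure hy (π := D.uniformPolicy) fun j =>
    (integral_dirac' _ _ (D.measurable_realizationWeight j).stronglyMeasurable).symm]
  refine fun hzero => ?_
  have hω' : (D.episodeMeasure (Function.update D.uniformPolicy i y)).real {ω} = 0 :=
    (measureReal_eq_zero_iff).2 (measure_mono_null (Set.singleton_subset_iff.2
      (show ω ∈ D.aoEvent i (ω.ao i t) from rfl)) hzero)
  rw [episodeMeasure_real_singleton, episodeProb_update] at hω'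
  exact mul_ne_zero (D.counterfactualWeight_uniformPolicy_pos i hω).ne' hyω hω'

variable (i) (μi)

theorem eqOn_realizationWeight_correspondingLocal :
    Set.EqOn (D.realizationWeight i (D.correspondingLocal i μi))
      (∫ x, D.realizationWeight i x ∂μi.toMeasure) (Function.support D.envWeight) := by
  obtain ⟨y, hy⟩ := D.exists_realizationWeight_eq_integral i μi.toMeasure
  rw [← hy]
  refine D.eqOn_realizationWeight_of_le i fun ω hω => ?_
  rcases eq_or_ne (D.realizationWeight i y ω) 0 with hzero | hne
  · exact hzero ▸ (D.realizationWeight_mem_Icc i _ ω).1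
  · exact Finset.prod_le_prod (fun t _ => stdSimplex.zero_le _ _) fun t _ =>
      (congrArg (fun p => p (ω.action t i)) (D.correspondingLocal_apply_of_reachable hy
        (D.exists_mixMeasure_update_aoEvent_ne_zero hy hω hne t))).ge

end CorrespondingLocal

namespace Iso

variable {D : DecPOMDP.{u} N T} {E : DecPOMDP.{v} N T} {F : DecPOMDP.{w} N T}

theorem ext_of_heq {f g : Iso D E} (hN : ∀ i, f.agent i = g.agent i)
    (hS : ∀ s, f.state s = g.state s) (hA : ∀ i a, f.action i a ≍ g.action i a)
    (hO : ∀ i o, f.ob i o ≍ g.ob i o) : f = g := by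
  obtain ⟨fN, fS, fA, fO, _, _, _, _⟩ := f
  obtain ⟨gN, gS, gA, gO, _, _, _, _⟩ := g
  obtain rfl : fN = gN := Equiv.ext hN
  obtain rfl : fS = gS := Equiv.ext hS
  obtain rfl : fA = gA := funext fun i => Equiv.ext fun a => eq_of_heq (hA i a)
  obtain rfl : fO = gO := funext fun i => Equiv.ext fun o => eq_of_heq (hO i o)
  rfl

/-- The identity isomorphism. -/
protected def refl (D : DecPOMDP.{u} N T) : Iso D D where
  agent := Equiv.refl _
  state := Equiv.refl _
  action _ := Equiv.refl _
  ob _ := Equiv.refl _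
  trans_eq _ _ _ := rfl
  obs_eq _ _ _ := rfl
  reward_eq _ _ := rfl
  init_eq _ := rfl

/-- The composition of isomorphisms, `f` first. -/
protected def trans (f : Iso D E) (g : Iso E F) : Iso D F where
  agent := f.agent.trans g.agent
  state := f.state.trans g.state
  action i := (f.action i).trans (g.action (f.agent i))
  ob i := (f.ob i).trans (g.ob (f.agent i))
  trans_eq s s' a := by
    rw [f.trans_eq, g.trans_eq, piCongr_trans_apply, Equiv.trans_apply, Equiv.trans_apply]
  obs_eq s a o := by
    rw [f.obs_eq, g.obs_eq, piCongr_trans_apply, piCongr_trans_apply, Equiv.trans_apply]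
  reward_eq s a := by rw [f.reward_eq, g.reward_eq, piCongr_trans_apply, Equiv.trans_apply]
  init_eq s := by rw [f.init_eq, g.init_eq, Equiv.trans_apply]

/-- The inverse isomorphism. -/
protected def symm (f : Iso D E) : Iso E D where
  agent := f.agent.symm
  state := f.state.symm
  action := familySymm f.agent f.action
  ob := familySymm f.agent f.ob
  trans_eq s s' a := by simp only [piCongr_familySymm_apply, f.trans_eq, Equiv.apply_symm_apply]
  obs_eq s a o := by simp only [piCongr_familySymm_apply, f.obs_eq, Equiv.apply_symm_apply]
  reward_eq s a := by simp only [piCongr_familySymm_apply, f.reward_eq, Equiv.apply_symm_apply]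
  init_eq s := by rw [f.init_eq, Equiv.apply_symm_apply]

theorem trans_symm_self (f : Iso D E) : f.trans f.symm = Iso.refl D :=
  ext_of_heq f.agent.symm_apply_apply f.state.symm_apply_apply
    (familySymm_apply_apply_heq f.agent f.action) (familySymm_apply_apply_heq f.agent f.ob)

theorem symm_trans_self (f : Iso D E) : f.symm.trans f = Iso.refl E :=
  ext_of_heq f.agent.apply_symm_apply f.state.apply_symm_apply
    (apply_familySymm_apply_heq f.agent f.action) (apply_familySymm_apply_heq f.agent f.ob)

/-- Precomposition with an isomorphism, as a bijection. -/
def precompEquiv (f : Iso D E) (F : DecPOMDP.{w} N T) : Iso E F ≃ Iso D F where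
  toFun := f.trans
  invFun := f.symm.trans
  left_inv g := congrArg (·.trans g) f.symm_trans_self
  right_inv h := congrArg (·.trans h) f.trans_symm_self

/-- Postcomposition with an isomorphism, as a bijection. -/
def postcompEquiv (D : DecPOMDP.{u} N T) (g : Iso E F) : Iso D E ≃ Iso D F where
  toFun f := f.trans g
  invFun h := h.trans g.symm
  left_inv f := congrArg f.trans g.trans_symm_self
  right_inv h := congrArg h.trans g.symm_trans_self

theorem push_refl (π : D.Policy) : (Iso.refl D).push π = π :=
  funext fun i => (Iso.refl D).push_apply π i

theorem push_trans (f : Iso D E) (g : Iso E F) (π : D.Policy) :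
    (f.trans g).push π = g.push (f.push π) := by
  funext k
  obtain ⟨i, rfl⟩ := (f.trans g).agent.surjective k
  rw [push_apply]
  change _ = g.push (f.push π) (g.agent (f.agent i))
  rw [push_apply, push_apply]
  rfl

theorem push_push_symm (f : Iso D E) (π : E.Policy) : f.push (f.symm.push π) = π := by
  rw [← push_trans, symm_trans_self, push_refl]

/-- The element-wise action of an isomorphism on episodes. -/
def episode (f : Iso D E) : D.Episode ≃ E.Episode where
  toFun ω := ⟨fun t => f.state (ω.state t), fun t => Equiv.piCongr f.agent f.action (ω.action t),
    fun t => Equiv.piCongr f.agent f.ob (ω.obsSeq t)⟩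
  invFun ω := ⟨fun t => f.state.symm (ω.state t),
    fun t => (Equiv.piCongr f.agent f.action).symm (ω.action t),
    fun t => (Equiv.piCongr f.agent f.ob).symm (ω.obsSeq t)⟩
  left_inv ω := by simp only [Equiv.symm_apply_apply]
  right_inv ω := by simp only [Equiv.apply_symm_apply]

theorem episode_action (f : Iso D E) (ω : D.Episode) (t : Fin (T + 1)) (i : Fin N) :
    (f.episode ω).action t (f.agent i) = f.action i (ω.action t i) :=
  Equiv.piCongr_apply_apply f.agent f.action (ω.action t) i

theorem episode_obsSeq (f : Iso D E) (ω : D.Episode) (t : Fin T) (i : Fin N) :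
    (f.episode ω).obsSeq t (f.agent i) = f.ob i (ω.obsSeq t i) :=
  Equiv.piCongr_apply_apply f.agent f.ob (ω.obsSeq t) i

theorem episode_ao (f : Iso D E) (ω : D.Episode) (t : Fin (T + 1)) (i : Fin N) :
    (f.episode ω).ao (f.agent i) t = f.aoMap i (ω.ao i t) := by
  simp only [Episode.ao, episode_action, episode_obsSeq]
  rfl

theorem envWeight_episode (f : Iso D E) (ω : D.Episode) :
    E.envWeight (f.episode ω) = D.envWeight ω := by
  simp only [envWeight, f.init_eq, f.trans_eq, f.obs_eq]
  rfl

theorem ret_episode (f : Iso D E) (ω : D.Episode) : (f.episode ω).ret = ω.ret := by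
  simp only [Episode.ret, f.reward_eq]
  rfl

theorem realizationWeight_push_comp_episode (f : Iso D E) (π : D.Policy) (i : Fin N) :
    E.realizationWeight (f.agent i) (f.push π (f.agent i)) ∘ f.episode =
      D.realizationWeight i (π i) := by
  funext ω
  simp only [Function.comp_apply, realizationWeight, push_apply, episode_ao, episode_action,
    localPush, simplexCongr_apply_apply, Equiv.symm_apply_apply]

end Iso

/-- A labeling as an isomorphism onto the relabeled Dec-POMDP. -/
def Labeling.toIso {D : DecPOMDP.{u} N T} (f : Labeling D) : Iso D f.relabel where
  agent := f.agent
  state := f.state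
  action i := (f.action i).trans (finCongr (by rw [Equiv.symm_apply_apply]))
  ob i := (f.ob i).trans (finCongr (by rw [Equiv.symm_apply_apply]))
  trans_eq s s' a := by
    change _ = simplexCongr f.state (D.trans (f.state.symm (f.state s))
      (f.jointAction.symm (f.jointAction a))) (f.state s')
    simp only [simplexCongr_apply_apply, Equiv.symm_apply_apply]
  obs_eq s a o := by
    change _ = simplexCongr f.jointObs (D.obs (f.state.symm (f.state s))
      (f.jointAction.symm (f.jointAction a))) (f.jointObs o)
    simp only [simplexCongr_apply_apply, Equiv.symm_apply_apply]
  reward_eq s a := by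
    change _ = D.reward (f.state.symm (f.state s)) (f.jointAction.symm (f.jointAction a))
    simp only [Equiv.symm_apply_apply]
  init_eq s := (simplexCongr_apply_apply f.state D.init s).symm

theorem nonempty_iso_of_mem_relabeled {D : DecPOMDP.{u} N T} {E : DecPOMDP.{0} N T}
    (hE : E ∈ D.relabeled) : Nonempty (Iso E D) := by
  obtain ⟨f, rfl⟩ := hE
  exact ⟨f.toIso.symm⟩

theorem nonempty_iso_relabeled {D : DecPOMDP.{u} N T} (E F : D.relabeled) :
    Nonempty (Iso E.1 F.1) :=
  Nonempty.map2 (fun f g => f.trans g.symm) (nonempty_iso_of_mem_relabeled E.2)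
    (nonempty_iso_of_mem_relabeled F.2)

instance (D : DecPOMDP.{u} N T) : Nonempty D.relabeled :=
  ⟨⟨_, ⟨Equiv.refl _, Fintype.equivFin _, fun _ => Fintype.equivFin _,
    fun _ => Fintype.equivFin _⟩, rfl⟩⟩

section ExpectedReturn

/-- The expected return as a multilinear function of the agents' contributions to the episode
probabilities. -/
def expectedReturn (D : DecPOMDP.{u} N T) :
    ContinuousMultilinearMap ℝ (fun _ : Fin N => D.Episode → ℝ) ℝ :=
  ∑ ω, (D.envWeight ω * ω.ret) •
    (ContinuousMultilinearMap.mkPiAlgebra ℝ (Fin N) ℝ).compContinuousLinearMap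
      fun _ => ContinuousLinearMap.proj ω

variable {D : DecPOMDP.{u} N T} {E : DecPOMDP.{v} N T} {r : Fin N → D.Episode → ℝ}

theorem expectedReturn_apply (r : Fin N → D.Episode → ℝ) :
    D.expectedReturn r = ∑ ω, D.envWeight ω * ω.ret * ∏ i, r i ω := by
  simp only [expectedReturn, sum_apply, smul_apply,
    ContinuousMultilinearMap.compContinuousLinearMap_apply,
    ContinuousMultilinearMap.mkPiAlgebra_apply, ContinuousLinearMap.proj_apply, smul_eq_mul]

theorem J_eq_expectedReturn (π : D.Policy) :
    D.J π = D.expectedReturn fun i => D.realizationWeight i (π i) := by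
  rw [J, integral_episodeMeasure, expectedReturn_apply]
  exact Finset.sum_congr rfl fun ω _ => by rw [episodeProb_eq, mul_right_comm]

theorem expectedReturn_congr {r' : Fin N → D.Episode → ℝ}
    (h : ∀ i, Set.EqOn (r i) (r' i) (Function.support D.envWeight)) :
    D.expectedReturn r = D.expectedReturn r' := by
  rw [expectedReturn_apply, expectedReturn_apply]
  refine Finset.sum_congr rfl fun ω _ => ?_
  rcases eq_or_ne (D.envWeight ω) 0 with hω | hω
  · simp only [hω, zero_mul]
  · rw [Finset.prod_congr rfl fun i _ => h i hω]

theorem expectedReturn_iso (f : Iso D E) {r' : Fin N → E.Episode → ℝ}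
    (h : ∀ i, r' (f.agent i) ∘ f.episode = r i) : E.expectedReturn r' = D.expectedReturn r := by
  rw [expectedReturn_apply, expectedReturn_apply, ← Equiv.sum_comp f.episode]
  refine Finset.sum_congr rfl fun ω _ => ?_
  rw [f.envWeight_episode, f.ret_episode, ← Equiv.prod_comp f.agent]
  exact congrArg _ (Finset.prod_congr rfl fun i _ => congrFun (h i) ω)

theorem expectedReturn_expect {κ : Fin N → Type*} [∀ i, Fintype (κ i)]
    (g : ∀ i, κ i → D.Episode → ℝ) :
    D.expectedReturn (fun i => 𝔼 k, g i k) =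
      𝔼 p : ∀ i, κ i, D.expectedReturn fun i => g i (p i) :=
  multilinearMap_map_expect (D.expectedReturn.toMultilinearMap.restrictScalars ℚ≥0) g

theorem expectedReturn_update_expect {κ : Type*} [Fintype κ] (r : Fin N → D.Episode → ℝ)
    (i : Fin N) (g : κ → D.Episode → ℝ) :
    D.expectedReturn (Function.update r i (𝔼 k, g k)) =
      𝔼 k, D.expectedReturn (Function.update r i (g k)) :=
  map_expect ((D.expectedReturn.toMultilinearMap.toLinearMap r i).restrictScalars ℚ≥0) g _

end ExpectedReturn

section OrbitAverage

variable {D : DecPOMDP.{u} N T} {E : DecPOMDP.{v} N T}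

/-- The averages, over all isomorphisms `f : Iso D E`, of the realization weights of `f^*π`. They
are the agents' expected contributions if every agent draws its own `f`. -/
def orbitAvg (E : DecPOMDP.{v} N T) (π : D.Policy) (l : Fin N) : E.Episode → ℝ :=
  𝔼 f : Iso D E, E.realizationWeight l (f.push π l)

theorem orbitAvg_push (f : Iso D E) (F : DecPOMDP.{w} N T) (π : D.Policy) :
    orbitAvg F (f.push π) = orbitAvg F π :=
  funext fun l => Fintype.expect_equiv (f.precompEquiv F) _ _ fun g =>
    congrArg (fun ρ : F.Policy => F.realizationWeight l (ρ l)) (f.push_trans g π).symm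

theorem orbitAvg_comp_episode {F : DecPOMDP.{w} N T} (g : Iso E F) (π : D.Policy)
    (l : Fin N) :
    orbitAvg F π (g.agent l) ∘ g.episode = orbitAvg E π l := by
  funext ω
  simp only [orbitAvg, Function.comp_apply, Finset.expect_apply]
  refine (Fintype.expect_equiv (Iso.postcompEquiv D g) _ _ fun f => ?_).symm
  rw [← g.realizationWeight_push_comp_episode, ← Iso.push_trans]
  rfl

theorem JOP_eq_expectedReturn (π : D.Policy) : D.JOP π = D.expectedReturn (orbitAvg D π) := by
  simp only [JOP, J_eq_expectedReturn]
  exact (expectedReturn_expect fun l (f : D.Aut) => D.realizationWeight l (f.push π l)).symm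

theorem JOP_push (f : Iso D E) (π : D.Policy) : E.JOP (f.push π) = D.JOP π := by
  rw [JOP_eq_expectedReturn, JOP_eq_expectedReturn, orbitAvg_push]
  exact expectedReturn_iso f (orbitAvg_comp_episode f π)

theorem push_mem_opOptimal (f : Iso D E) {π : D.Policy} (hπ : π ∈ D.opOptimal) :
    f.push π ∈ E.opOptimal := by
  intro π'
  rw [JOP_push, ← f.push_push_symm π', JOP_push]
  exact hπ _

theorem convex_range_orbitAvg (D : DecPOMDP.{u} N T) (E : DecPOMDP.{v} N T) :
    Convex ℝ (Set.range (orbitAvg (D := D) E)) := by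
  rintro _ ⟨x, rfl⟩ _ ⟨y, rfl⟩ a b ha hb hab
  choose z hz using fun i => D.convex_range_realizationWeight i (Set.mem_range_self (x i))
    (Set.mem_range_self (y i)) ha hb hab
  refine ⟨z, funext fun l => ?_⟩
  simp only [orbitAvg, Pi.add_apply, Pi.smul_apply, Finset.smul_expect,
    ← Finset.expect_add_distrib]
  refine Finset.expect_congr rfl fun f _ => ?_
  obtain ⟨i, rfl⟩ := f.agent.surjective l
  refine f.episode.surjective.injective_comp_right ?_
  exact (f.realizationWeight_push_comp_episode z i).trans ((hz i).trans (congrArg₂ _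
    (congrArg _ (f.realizationWeight_push_comp_episode x i).symm)
    (congrArg _ (f.realizationWeight_push_comp_episode y i).symm)))

theorem isMaxOn_expectedReturn_orbitAvg {π : D.Policy} (hπ : π ∈ D.opOptimal) :
    IsMaxOn D.expectedReturn (Set.range (orbitAvg (D := D) D)) (orbitAvg D π) := by
  rintro _ ⟨ρ, rfl⟩
  have hle := hπ ρ
  rwa [JOP_eq_expectedReturn, JOP_eq_expectedReturn] at hle

theorem integral_opDist_marginal (π : D.Policy) (i : Fin N) :
    ∫ x, D.realizationWeight i x ∂((D.opDist π).map (measurable_pi_apply i).aemeasurable :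
      Measure (D.LocalPolicy i)) = orbitAvg D π i := by
  rw [ProbabilityMeasure.toMeasure_map, integral_map (measurable_pi_apply i).aemeasurable
    (D.measurable_realizationWeight i).aestronglyMeasurable]
  change ∫ ρ, D.realizationWeight i (ρ i) ∂((Fintype.card (Fin N → D.Aut) : ℝ≥0∞)⁻¹ •
    ∑ g : Fin N → D.Aut, Measure.dirac (D.profilePush g π)) = _
  rw [integral_smul_measure, integral_finsetSum_measure fun g _ =>
    D.integrable_realizationWeight_apply i _]
  simp only [integral_dirac' _ _ (D.measurable_realizationWeight_apply i).stronglyMeasurable,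
    profilePush]
  rw [orbitAvg, ← expect_pi_eval (κ := fun _ => D.Aut) i, Finset.expect_univ,
    ← NNRat.cast_smul_eq_nnqsmul ℝ, NNRat.cast_inv, NNRat.cast_natCast, ENNReal.toReal_inv,
    ENNReal.toReal_natCast]

theorem orbitAvg_mem_range_realizationWeight (π : D.Policy) (i : Fin N) :
    orbitAvg D π i ∈ Set.range (D.realizationWeight i) :=
  integral_opDist_marginal π i ▸ D.exists_realizationWeight_eq_integral i _

theorem eqOn_orbitAvg_of_equivalent {π π' : D.Policy} (h : D.Equivalent π π') (i : Fin N) :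
    Set.EqOn (orbitAvg D π i) (orbitAvg D π' i) (Function.support D.envWeight) := by
  have hsymm (π : D.Policy) : Set.EqOn (D.realizationWeight i (D.symmetrizer π i))
      (orbitAvg D π i) (Function.support D.envWeight) :=
    integral_opDist_marginal π i ▸ D.eqOn_realizationWeight_correspondingLocal i _
  exact (hsymm π).symm.trans (congrFun h i ▸ hsymm π')

theorem sum_expectedReturn_update_orbitAvg (π ρ : D.Policy) :
    ∑ l, D.expectedReturn (Function.update (orbitAvg D π) l (orbitAvg D ρ l)) =
      ∑ i, D.expectedReturn
        (Function.update (orbitAvg D π) i (D.realizationWeight i (ρ i))) := by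
  have hpush (f : D.Aut) (i : Fin N) : D.expectedReturn (Function.update (orbitAvg D π)
        (f.agent i) (D.realizationWeight (f.agent i) (f.push ρ (f.agent i)))) =
      D.expectedReturn (Function.update (orbitAvg D π) i (D.realizationWeight i (ρ i))) := by
    refine expectedReturn_iso f fun j => ?_
    rcases eq_or_ne j i with rfl | hj
    · rw [Function.update_self, Function.update_self, f.realizationWeight_push_comp_episode]
    · rw [Function.update_of_ne hj, Function.update_of_ne (f.agent.injective.ne hj),
        orbitAvg_comp_episode]
  simp only [orbitAvg.eq_def D ρ, expectedReturn_update_expect]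
  rw [← Finset.expect_sum_comm]
  refine (Finset.expect_congr rfl fun f _ => ?_).trans (Fintype.expect_const _)
  rw [← Equiv.sum_comp f.agent]
  exact Finset.sum_congr rfl fun i _ => hpush f i

theorem sum_expectedReturn_update_le {π : D.Policy} (hπ : π ∈ D.opOptimal) (ρ : D.Policy) :
    ∑ i, D.expectedReturn (Function.update (orbitAvg D π) i (D.realizationWeight i (ρ i))) ≤
      N * D.expectedReturn (orbitAvg D π) := by
  rw [← sum_expectedReturn_update_orbitAvg]
  simpa only [Fintype.card_fin] using sum_update_le_of_isMaxOn D.expectedReturn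
    (convex_range_orbitAvg D D) (Set.mem_range_self π) (Set.mem_range_self ρ)
    (isMaxOn_expectedReturn_orbitAvg hπ)

theorem expectedReturn_update_le {π : D.Policy} (hπ : π ∈ D.opOptimal) (i : Fin N)
    (x : D.LocalPolicy i) :
    D.expectedReturn (Function.update (orbitAvg D π) i (D.realizationWeight i x)) ≤
      D.expectedReturn (orbitAvg D π) := by
  choose z hz using orbitAvg_mem_range_realizationWeight π
  have hstay (j : Fin N) (hj : j ≠ i) : D.expectedReturn (Function.update (orbitAvg D π) j
      (D.realizationWeight j (Function.update z i x j))) = D.expectedReturn (orbitAvg D π) := by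
    rw [Function.update_of_ne hj, hz, Function.update_eq_self]
  have hsum := sum_expectedReturn_update_le hπ (Function.update z i x)
  have hconst : N * D.expectedReturn (orbitAvg D π) =
      ∑ _j : Fin N, D.expectedReturn (orbitAvg D π) := by
    rw [Finset.sum_const, Finset.card_univ, Fintype.card_fin, nsmul_eq_mul]
  rw [hconst, ← sub_nonpos, ← Finset.sum_sub_distrib, Finset.sum_eq_single i
    (fun j _ hj => sub_eq_zero.2 (hstay j hj)) fun h => (h (Finset.mem_univ i)).elim,
    Function.update_self, sub_nonpos] at hsum
  exact hsum

end OrbitAverage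

section Game

variable {D : DecPOMDP.{u} N T} {E : DecPOMDP.{v} N T}

theorem integral_J_pi (ν : Fin N → Measure D.Policy) [∀ l, IsProbabilityMeasure (ν l)] :
    ∫ π : Fin N → D.Policy, D.J (fun l => π l l) ∂(Measure.pi ν) =
      D.expectedReturn fun l => ∫ π, D.realizationWeight l (π l) ∂(ν l) := by
  have hint (l : Fin N) := D.integrable_realizationWeight_apply l (ν l)
  simp only [J_eq_expectedReturn, expectedReturn_apply]
  rw [integral_finsetSum _ fun ω _ => (Integrable.fintype_prod fun l =>
    (hint l).eval ω).const_mul _]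
  refine Finset.sum_congr rfl fun ω _ => ?_
  rw [integral_const_mul,
    integral_fintype_prod_eq_prod fun l (π : D.Policy) => D.realizationWeight l (π l) ω]
  simp only [eval_integral fun ω => (hint _).eval ω]

theorem integrable_realizationWeight_push (f : Iso D E) (l : Fin N) (μ : Measure D.Policy)
    [IsFiniteMeasure μ] : Integrable (fun π => E.realizationWeight l (f.push π l)) μ :=
  (E.integrable_realizationWeight_apply l _).comp_measurable f.measurable_push

theorem exists_realizationWeight_eq_integral_push (f : Iso D E) (l : Fin N)
    (μ : Measure D.Policy) [IsProbabilityMeasure μ] :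
    ∃ x, E.realizationWeight l x = ∫ π, E.realizationWeight l (f.push π l) ∂μ := by
  have hmeas : AEMeasurable (fun π => f.push π l) μ :=
    ((measurable_pi_apply l).comp f.measurable_push).aemeasurable
  have := Measure.isProbabilityMeasure_map hmeas
  rw [← integral_map hmeas (E.measurable_realizationWeight l).aestronglyMeasurable]
  exact E.exists_realizationWeight_eq_integral l _

/-- The expected contribution of agent `l` to the episode probabilities in the label-free
coordination game if its principal uses the learning algorithm `σ`. -/
def algorithmWeight (D : DecPOMDP.{u} N T) (σ : LearningAlgorithm D.relabeled) (l : Fin N) :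
    D.Episode → ℝ :=
  𝔼 E : D.relabeled, 𝔼 f : Iso E.1 D,
    ∫ π, D.realizationWeight l (f.push π l) ∂(σ E : Measure E.1.Policy)

theorem payoff_eq_expectedReturn (σ : Fin N → LearningAlgorithm D.relabeled) :
    D.payoff σ = D.expectedReturn fun l => D.algorithmWeight (σ l) l := by
  have hpush (E : D.relabeled) (f : Iso E.1 D) (ν : ProbabilityMeasure E.1.Policy) (l : Fin N) :
      ∫ π, D.realizationWeight l (π l) ∂(f.pushDist ν : Measure D.Policy) =
        ∫ π, D.realizationWeight l (f.push π l) ∂(ν : Measure E.1.Policy) :=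
    integral_map f.measurable_push.aemeasurable
      (D.measurable_realizationWeight_apply l).aestronglyMeasurable
  simp only [payoff, integral_J_pi, hpush]
  rw [Finset.expect_congr rfl fun (Ds : Fin N → D.relabeled) _ =>
    (expectedReturn_expect fun l (f : Iso (Ds l).1 D) => ∫ π, D.realizationWeight l (f.push π l)
      ∂(σ l (Ds l) : Measure (Ds l).1.Policy)).symm]
  exact (expectedReturn_expect fun l (E : D.relabeled) => 𝔼 f : Iso E.1 D,
    ∫ π, D.realizationWeight l (f.push π l) ∂(σ l E : Measure E.1.Policy)).symm

theorem algorithmWeight_mem_range_realizationWeight (σ : LearningAlgorithm D.relabeled)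
    (l : Fin N) : D.algorithmWeight σ l ∈ Set.range (D.realizationWeight l) := by
  have hconvex := D.convex_range_realizationWeight l
  refine expect_mem_of_convex hconvex fun E => ?_
  have := nonempty_iso_of_mem_relabeled E.2
  exact expect_mem_of_convex hconvex fun f => exists_realizationWeight_eq_integral_push f l _

theorem algorithmWeight_eq_expect_integral_orbitAvg (σ : LearningAlgorithm D.relabeled)
    (l : Fin N) : D.algorithmWeight σ l =
      𝔼 E : D.relabeled, ∫ π, orbitAvg D π l ∂(σ E : Measure E.1.Policy) :=
  Finset.expect_congr rfl fun _ _ =>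
    (integral_expect fun f => integrable_realizationWeight_push f l _).symm

theorem integrable_orbitAvg (E : DecPOMDP.{v} N T) (l : Fin N) (μ : Measure D.Policy)
    [IsFiniteMeasure μ] : Integrable (fun π => orbitAvg E π l) μ := by
  simp only [orbitAvg, Finset.expect_univ, ← NNRat.cast_smul_eq_nnqsmul ℝ]
  exact (integrable_finsetSum _ fun f _ => integrable_realizationWeight_push f l μ).smul (_ : ℝ)

theorem eqOn_orbitAvg_of_equivalent_push {F : DecPOMDP.{w} N T} {π : D.Policy} {ρ : E.Policy}
    (f : Iso D E) (g : Iso E F) (h : E.Equivalent (f.push π) ρ) (l : Fin N) :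
    Set.EqOn (orbitAvg F π l) (orbitAvg F ρ l) (Function.support F.envWeight) := by
  obtain ⟨i, rfl⟩ := g.agent.surjective l
  intro ω hω
  obtain ⟨ω, rfl⟩ := g.episode.surjective ω
  rw [Function.mem_support, g.envWeight_episode] at hω
  have heq := eqOn_orbitAvg_of_equivalent h i hω
  rwa [orbitAvg_push, ← orbitAvg_comp_episode g, ← orbitAvg_comp_episode g] at heq

theorem eqOn_algorithmWeight_orbitAvg {ρ : E.Policy} (g : Iso E D)
    {σ : LearningAlgorithm D.relabeled} (h : ∀ F : D.relabeled,
      ∀ᵐ π ∂(σ F : Measure F.1.Policy), ∃ f : Iso F.1 E, E.Equivalent (f.push π) ρ)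
    (l : Fin N) :
    Set.EqOn (D.algorithmWeight σ l) (orbitAvg D ρ l) (Function.support D.envWeight) := by
  intro ω hω
  rw [algorithmWeight_eq_expect_integral_orbitAvg, Finset.expect_apply]
  refine (Finset.expect_congr rfl fun F _ => ?_).trans (Fintype.expect_const _)
  have hae : ∀ᵐ π ∂(σ F : Measure F.1.Policy), orbitAvg D π l ω = orbitAvg D ρ l ω := by
    filter_upwards [h F] with π ⟨f, hf⟩
    exact eqOn_orbitAvg_of_equivalent_push f g hf l hω
  rw [eval_integral fun ω => (integrable_orbitAvg D l _).eval ω, integral_congr_ae hae,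
    integral_const, probReal_univ, one_smul]

theorem exists_ae_equivalent_of_isOPWithTieBreaking {C : Set (DecPOMDP.{u} N T)}
    (hC : ∀ E F : C, Nonempty (Iso E.1 F.1))
    {χ : ∀ E : C, E.1.Policy → Set.Icc (0 : ℝ) 1} (hχ : IsTieBreaking C χ)
    (hinv : InvariantToIso C χ) {σ : LearningAlgorithm C} (hσ : IsOPWithTieBreaking C χ σ)
    (F : C) : ∃ ρ ∈ F.1.opOptimal, ∀ E : C, ∀ᵐ π ∂(σ E : Measure E.1.Policy),
      ∃ f : Iso E.1 F.1, F.1.Equivalent (f.push π) ρ := by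
  obtain ⟨ρ, hρ, hρmax⟩ := hχ.attains_max F
  refine ⟨ρ, hρ, fun E => ?_⟩
  obtain ⟨f⟩ := hC E F
  have hpush (π : E.1.Policy) : χ F (f.push π) = χ E π := (hinv E F f π _ rfl).symm
  obtain ⟨Z, hZ, -, hZ1, hZmax⟩ := hσ E
  filter_upwards [(mem_ae_iff_prob_eq_one hZ).2 hZ1] with π hπ
  obtain ⟨hopt, hmax⟩ := hZmax hπ
  refine ⟨f, hχ.equivalent_of_eq F _ _ (le_antisymm (hρmax _ (push_mem_opOptimal f hopt)) ?_)⟩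
  rw [← f.push_push_symm ρ, hpush, hpush]
  exact hmax _ (push_mem_opOptimal f.symm hρ)

end Game

end DecPOMDP

end

theorem mainTheorem3_general {N T : ℕ} (D : DecPOMDP.{u} N T) {E : DecPOMDP.{v} N T}
    (g : DecPOMDP.Iso E D) {ρ : E.Policy} (hρ : ρ ∈ E.opOptimal)
    (σ : Fin N → DecPOMDP.LearningAlgorithm D.relabeled)
    (hσ : ∀ l, ∀ F : D.relabeled, ∀ᵐ π ∂(σ l F : Measure F.1.Policy),
      ∃ f : DecPOMDP.Iso F.1 E, E.Equivalent (f.push π) ρ) :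
    D.IsNashEquilibrium σ := by
  intro i σ'
  have hweight (l : Fin N) := DecPOMDP.eqOn_algorithmWeight_orbitAvg g (hσ l) l
  obtain ⟨x, hx⟩ := DecPOMDP.algorithmWeight_mem_range_realizationWeight σ' i
  calc D.payoff (Function.update σ i σ')
    _ = D.expectedReturn (Function.update (DecPOMDP.orbitAvg D ρ) i
          (D.realizationWeight i x)) := by
        rw [DecPOMDP.payoff_eq_expectedReturn]
        refine DecPOMDP.expectedReturn_congr fun l => ?_
        rcases eq_or_ne l i with rfl | hl
        · simpa only [Function.update_self, hx] using Set.eqOn_refl _ _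
        · simpa only [Function.update_of_ne hl] using hweight l
    _ ≤ D.expectedReturn (DecPOMDP.orbitAvg D ρ) := by
        rw [← DecPOMDP.orbitAvg_push g D ρ]
        exact DecPOMDP.expectedReturn_update_le (DecPOMDP.push_mem_opOptimal g hρ) i x
    _ = D.payoff σ := by
        rw [DecPOMDP.payoff_eq_expectedReturn, DecPOMDP.expectedReturn_congr hweight]

theorem mainTheorem3 {N T : ℕ} (D : DecPOMDP.{u} N T)
    (χ : ∀ E : D.relabeled, E.1.Policy → Set.Icc (0 : ℝ) 1)
    (hχ : DecPOMDP.IsTieBreaking D.relabeled χ)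
    (hinv : DecPOMDP.InvariantToIso D.relabeled χ)
    (σ : DecPOMDP.LearningAlgorithm D.relabeled)
    (hσ : DecPOMDP.IsOPWithTieBreaking D.relabeled χ σ) :
    D.IsNashEquilibrium (fun _ => σ) := by
  obtain ⟨E⟩ : Nonempty D.relabeled := inferInstance
  obtain ⟨g⟩ := DecPOMDP.nonempty_iso_of_mem_relabeled E.2
  obtain ⟨ρ, hρ, hae⟩ := DecPOMDP.exists_ae_equivalent_of_isOPWithTieBreaking
    DecPOMDP.nonempty_iso_relabeled hχ hinv hσ E
  exact mainTheorem3_general D g hρ _ fun _ => hae
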